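/- All quantum systems are finite-dimensional. A \emph{quantum encoding} of $x_0,x_1\in\{0,1\}^n$ consists of a probability distribution $\pi_{x_0,x_1}$ on pairs of strings and a density matrix $\rho_{x_0,x_1}$ on a common system for every pair. For a function $f$ of the pair with values in $\{0,1\}^n$ and a measurement (POVM) $E=(E_s)_{s\in\{0,1\}^n}$, the probability of decoding $f$ with $E$ is $\sum_{x_0,x_1}\pi_{x_0,x_1}\mathrm{Tr}(E_{f(x_0,x_1)}\rho_{x_0,x_1})$, and $\Pr[\text{learn } f(x_0,x_1)]$ is its maximum over all $E$. The encoding \emph{hides the XOR} if $\Pr[\text{learn } x_0\oplus x_1]=2^{-n}$. For $c\in\{0,1\}^n$, the mixed string $x_c\in\{0,1\}^n$ is defined by $(x_c)_i:=(x_{c_i})_i$. An \emph{$\mathrm{OT}_p^{\otimes n}$ protocol} is a quantum protocol without inputs between Alice and Bob, in which they start with independent states and in each of finitely many rounds Alice sends a message to Bob, who answers (except in the last round); Alice outputs $(z_0,z_1)\in(\{0,1\}^n)^2$ or Abort, and Bob outputs $(b,w)\in(\{0,1\}^n)^2$ or Abort. If both are honest, nobody aborts, $(z_0,z_1)$ is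 uniformly distributed, $b$ is uniformly distributed, and $w=z_b$ (where $(z_b)_i=(z_{b_i})_i$) with probability $p$. It is \emph{non-interactive} if the only communication is one message from Alice to Bob. It is \emph{secure} if no cheating Alice gains information about $b$ without Bob aborting, and no cheating Bob gains information about $z_0\oplus z_1$ without Alice aborting; that is, for every cheating strategy and every guess of the cheater, $\Pr[\text{the guess is correct and the honest party does not abort}]=2^{-n}\Pr[\text{the honest party does not abort}]$. In the game $\mathrm{CHSH}^{\otimes n}$, Alice and Bob share an entangled state, receive independent uniformly random $x\in\{0,1\}^n$ and $y\in\{0,1\}^n$, respectively, answer $a\in\{0,1\}^n$ and $b\in\{0,1\}^n$ without communicating, and win if $a_i\oplus b_i=x_i y_i$ for all $i$. \textbf{Theorem.} For every $n\in\mathbb{N}$ and every real $p\ge 2^{-n}$, the following are equivalent: (1) there is an encoding of $x_0,x_1\in\{0,1\}^n$ that hides the XOR and satisfies $\frac{1}{2^n}\sum_{c\in\{0,1\}^n}\Pr[\text{learn } x_c]=p$; (2) there is a secure, non-interactive $\mathrm{OT}_p^{\otimes n}$ protocol; (3) there is a secure $\mathrm{OT}_p^{\otimes n}$ protocol; (4)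 there is a strategy for $\mathrm{CHSH}^{\otimes n}$ that wins with probability $p$. Moreover, for every $n\in\mathbb{N}$ and every real $p$, the statements (2), (3) and (4) are equivalent to each other and to (1'): there are an encoding of $x_0,x_1\in\{0,1\}^n$ that hides the XOR and measurements $D^c$, $c\in\{0,1\}^n$, such that $\frac{1}{2^n}\sum_{c}p_c=p$, where $p_c$ is the probability of decoding $x_c$ with $D^c$. -/

import Mathlib

open scoped Matrix Kronecker ComplexOrder

/-- `n`-bit strings. A bit is an element of `ZMod 2`, so `+` is the bitwise XOR. -/
abbrev Bits (n : ℕ) : Type := Fin n → ZMod 2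

/-- The mixed string `x_c`: its `i`-th bit is the `i`-th bit of `x_{c_i}`. -/
def mix {n : ℕ} (c x₀ x₁ : Bits n) : Bits n := fun i => if c i = 0 then x₀ i else x₁ i

/-- Density matrices: states of the quantum system with orthonormal basis indexed by `H`. -/
structure IsDensity {H : Type} [Fintype H] (ρ : Matrix H H ℂ) : Prop where
  posSemidef : ρ.PosSemidef
  trace_eq_one : ρ.trace = 1

/-- Quantum measurements with outcomes in `K` (positive operator valued measures). -/
structure IsPOVM {K H : Type} [Fintype K] [Fintype H] [DecidableEq H]
    (E : K → Matrix H H ℂ) : Prop where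
  posSemidef : ∀ k, (E k).PosSemidef
  sum_eq_one : ∑ k, E k = 1

/-! ### Quantum encodings -/

/-- A quantum encoding of a pair of `n`-bit strings: a distribution of the pair and, for every
pair, a state of one and the same finite-dimensional quantum system. -/
structure Encoding (n : ℕ) where
  /-- index set of a basis of the system -/
  H : Type
  [fintypeH : Fintype H]
  [decEqH : DecidableEq H]
  /-- the distribution of the pair `(x₀, x₁)` -/
  prior : Bits n → Bits n → ℝ
  prior_nonneg : ∀ x₀ x₁, 0 ≤ prior x₀ x₁
  prior_sum : ∑ x₀, ∑ x₁, prior x₀ x₁ = 1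
  /-- the state that encodes `(x₀, x₁)` -/
  state : Bits n → Bits n → Matrix H H ℂ
  isDensity : ∀ x₀ x₁, IsDensity (state x₀ x₁)

attribute [instance] Encoding.fintypeH Encoding.decEqH

namespace Encoding

variable {n : ℕ}

/-- The probability that the measurement `E` of the encoding outputs `f x₀ x₁`. -/
noncomputable def decodeProb (e : Encoding n) (f : Bits n → Bits n → Bits n)
    (E : Bits n → Matrix e.H e.H ℂ) : ℝ :=
  ∑ x₀, ∑ x₁, e.prior x₀ x₁ * ((E (f x₀ x₁) * e.state x₀ x₁).trace).re

/-- `Pr[learn f(x₀, x₁)]`: the maximum over all measurements of the probability of decoding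
`f x₀ x₁` correctly. -/
noncomputable def learnProb (e : Encoding n) (f : Bits n → Bits n → Bits n) : ℝ :=
  ⨆ E : {E : Bits n → Matrix e.H e.H ℂ // IsPOVM E}, e.decodeProb f E.1

/-- The encoding hides the XOR: `x₀ ⊕ x₁` cannot be learnt better than by a uniformly random
guess. -/
def HidesXor (e : Encoding n) : Prop :=
  e.learnProb (fun x₀ x₁ => x₀ + x₁) = 1 / 2 ^ n

end Encoding

/-! ### Two-party quantum protocols -/

/-- A quantum channel (completely positive trace preserving map) given by Kraus operators. -/
structure Channel (H : Type) [Fintype H] [DecidableEq H] where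
  rank : ℕ
  kraus : Fin rank → Matrix H H ℂ
  complete : ∑ j, (kraus j)ᴴ * kraus j = 1

/-- What Alice does in a protocol with message register `M`: she has a private register `A`,
prepares `A` and `M` in the state `start`, and in round `t` applies `op t` to `A` and `M`
before she hands `M` to Bob. -/
structure AliceStrategy (M : Type) [Fintype M] [DecidableEq M] where
  A : Type
  [fintypeA : Fintype A]
  [decEqA : DecidableEq A]
  start : Matrix (A × M) (A × M) ℂ
  isDensity : IsDensity start
  op : ℕ → Channel (A × M)

attribute [instance] AliceStrategy.fintypeA AliceStrategy.decEqA

/-- What Bob does: he has a private register `B`, prepares it in the state `start`, and in round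
`t` applies `op t` to `M` and `B` after he has received `M`; he hands `M` back to Alice unless
this was the last round. -/
structure BobStrategy (M : Type) [Fintype M] [DecidableEq M] where
  B : Type
  [fintypeB : Fintype B]
  [decEqB : DecidableEq B]
  start : Matrix B B ℂ
  isDensity : IsDensity start
  op : ℕ → Channel (M × B)

attribute [instance] BobStrategy.fintypeB BobStrategy.decEqB

section Interaction

variable {M : Type} [Fintype M] [DecidableEq M]

/-- An operator on Alice's register and the message, as an operator on all three registers. -/
def onAlice {A B : Type} [DecidableEq B] (K : Matrix (A × M) (A × M) ℂ) :
    Matrix (A × M × B) (A × M × B) ℂ :=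
  (K ⊗ₖ (1 : Matrix B B ℂ)).reindex (Equiv.prodAssoc A M B) (Equiv.prodAssoc A M B)

/-- An operator on the message and Bob's register, as an operator on all three registers. -/
def onBob {A B : Type} [DecidableEq A] (K : Matrix (M × B) (M × B) ℂ) :
    Matrix (A × M × B) (A × M × B) ℂ :=
  (1 : Matrix A A ℂ) ⊗ₖ K

/-- The joint state of Alice's register, the message and Bob's register after `t` rounds. -/
noncomputable def jointState (S : AliceStrategy M) (T : BobStrategy M) :
    ℕ → Matrix (S.A × M × T.B) (S.A × M × T.B) ℂ
  | 0 => (S.start ⊗ₖ T.start).reindex (Equiv.prodAssoc S.A M T.B) (Equiv.prodAssoc S.A M T.B)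
  | t + 1 =>
    ∑ j, onBob ((T.op t).kraus j) *
      (∑ i, onAlice ((S.op t).kraus i) * jointState S T t * (onAlice ((S.op t).kraus i))ᴴ) *
      (onBob ((T.op t).kraus j))ᴴ

/-- The probability, after `k` rounds, that Alice obtains the outcome with effect `E` when she
measures her register and Bob obtains the outcome with effect `F` when he measures the message
register (which he holds at the end) and his own register. -/
noncomputable def outcomeProb (k : ℕ) (S : AliceStrategy M) (T : BobStrategy M)
    (E : Matrix S.A S.A ℂ) (F : Matrix (M × T.B) (M × T.B) ℂ) : ℝ :=
  (((E ⊗ₖ F) * jointState S T k).trace).re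

end Interaction

/-! ### Oblivious transfer -/

/-- A two-party protocol of the format of `n`-fold oblivious transfer: at the end Alice outputs
`some (z₀, z₁)` or aborts (`none`), and Bob outputs `some (b, w)` or aborts (`none`). -/
structure Protocol (n : ℕ) where
  /-- the message register -/
  M : Type
  [fintypeM : Fintype M]
  [decEqM : DecidableEq M]
  /-- number of rounds; in each of them Alice sends a message to Bob, and in each of them but the
  last one Bob answers -/
  rounds : ℕ
  alice : AliceStrategy M
  bob : BobStrategy M
  aliceOut : Option (Bits n × Bits n) → Matrix alice.A alice.A ℂ
  aliceOut_isPOVM : IsPOVM aliceOut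
  bobOut : Option (Bits n × Bits n) → Matrix (M × bob.B) (M × bob.B) ℂ
  bobOut_isPOVM : IsPOVM bobOut

attribute [instance] Protocol.fintypeM Protocol.decEqM

namespace Protocol

variable {n : ℕ}

/-- The joint distribution of the outputs when both parties are honest. -/
noncomputable def honestProb (P : Protocol n) (u v : Option (Bits n × Bits n)) : ℝ :=
  outcomeProb P.rounds P.alice P.bob (P.aliceOut u) (P.bobOut v)

/-- `P` is an `n`-fold oblivious transfer protocol with correctness `p`: if both parties are
honest, then nobody aborts, Alice's strings are independent and uniform, Bob's index string is
uniform, and `w = z_b` holds with probability `p`. -/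
structure IsOT (P : Protocol n) (p : ℝ) : Prop where
  alice_no_abort : ∑ v, P.honestProb none v = 0
  bob_no_abort : ∑ u, P.honestProb u none = 0
  alice_uniform : ∀ z₀ z₁, ∑ v, P.honestProb (some (z₀, z₁)) v = 1 / 2 ^ n * (1 / 2 ^ n)
  bob_uniform : ∀ b, ∑ u, ∑ w, P.honestProb u (some (b, w)) = 1 / 2 ^ n
  correct : ∑ z₀, ∑ z₁, ∑ b, P.honestProb (some (z₀, z₁)) (some (b, mix b z₀ z₁)) = p

/-- Whatever a cheating Alice `S` does, given that Bob does not abort, she guesses Bob's index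
string `b` only with the probability `1 / 2 ^ n` of a random guess, by any measurement `G`. -/
def SecureAgainstAlice (P : Protocol n) : Prop :=
  ∀ (S : AliceStrategy P.M) (G : Bits n → Matrix S.A S.A ℂ), IsPOVM G →
    ∑ b, ∑ w, outcomeProb P.rounds S P.bob (G b) (P.bobOut (some (b, w))) =
      1 / 2 ^ n * ∑ b, ∑ w, outcomeProb P.rounds S P.bob 1 (P.bobOut (some (b, w)))

/-- Whatever a cheating Bob `T` does, given that Alice does not abort, he guesses `z₀ ⊕ z₁`
only with the probability `1 / 2 ^ n` of a random guess, by any measurement `G`. -/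
def SecureAgainstBob (P : Protocol n) : Prop :=
  ∀ (T : BobStrategy P.M) (G : Bits n → Matrix (P.M × T.B) (P.M × T.B) ℂ), IsPOVM G →
    ∑ z₀, ∑ z₁, outcomeProb P.rounds P.alice T (P.aliceOut (some (z₀, z₁))) (G (z₀ + z₁)) =
      1 / 2 ^ n *
        ∑ z₀, ∑ z₁, outcomeProb P.rounds P.alice T (P.aliceOut (some (z₀, z₁))) 1

/-- Security against both parties. -/
def Secure (P : Protocol n) : Prop :=
  P.SecureAgainstAlice ∧ P.SecureAgainstBob

/-- The only communication is one message from Alice to Bob. -/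
def NonInteractive (P : Protocol n) : Prop :=
  P.rounds = 1

end Protocol

/-! ### The `n`-fold parallel repetition of the CHSH game -/

/-- A quantum strategy: a shared pure state of registers `A` and `B`, a measurement of `A` for
every question `x` to Alice, and a measurement of `B` for every question `y` to Bob. -/
structure CHSHStrategy (n : ℕ) where
  A : Type
  [fintypeA : Fintype A]
  [decEqA : DecidableEq A]
  B : Type
  [fintypeB : Fintype B]
  [decEqB : DecidableEq B]
  ψ : A × B → ℂ
  norm_ψ : star ψ ⬝ᵥ ψ = 1
  alice : Bits n → Bits n → Matrix A A ℂ
  alice_isPOVM : ∀ x, IsPOVM (alice x)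
  bob : Bits n → Bits n → Matrix B B ℂ
  bob_isPOVM : ∀ y, IsPOVM (bob y)

attribute [instance] CHSHStrategy.fintypeA CHSHStrategy.decEqA CHSHStrategy.fintypeB
  CHSHStrategy.decEqB

namespace CHSHStrategy

variable {n : ℕ}

/-- The probability of the answers `a`, `b` to the questions `x`, `y`. -/
noncomputable def answerProb (S : CHSHStrategy n) (x y a b : Bits n) : ℝ :=
  (star S.ψ ⬝ᵥ ((S.alice x a ⊗ₖ S.bob y b) *ᵥ S.ψ)).re

/-- The winning probability for independent, uniformly random questions. -/
noncomputable def winProb (S : CHSHStrategy n) : ℝ :=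
  ∑ x, ∑ y, 1 / 2 ^ n * (1 / 2 ^ n) *
    ∑ a, ∑ b, if ∀ i, a i + b i = x i * y i then S.answerProb x y a b else 0

end CHSHStrategy

/-! The hub is the version of (1) with given measurements `D c`; everything else is linked to it
through steering of a bipartite pure state. Hiding the XOR, stated through an optimal guess, is
first made structural: averaging over shifted guesses shows that every measurement succeeds with
probability exactly `1 / 2 ^ n` (`Encoding.HidesXor.decodeProb_eq`), and a constant success
probability forces the conditional states given the XOR to coincide (`eq_of_trace_povm_const`,
`Encoding.HidesXor.xorState_eq`).

CHSH and encodings. The winning condition says `b = mix y a (a + x)`. Take Bob's system, given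
question `x` and answer `a`, as the encoding of the pair `(a, a + x)`: the XOR is the question, and
it is hidden by no-signalling. Conversely, if the XOR is hidden, the ensembles belonging to the
various XORs `x` average to one state, so measurements of a purification, one for each `x`, prepare
them all (`exists_isPOVM_steering`).

From encoding to protocol. Alice sends the encoding of her strings, both shifted by a random pad,
together with the pad. The shift preserves the XOR, makes her strings uniform and commutes with
`mix`. Bob picks his index himself and sends nothing, so Alice learns nothing.

From protocol to encoding. Let both parties purify their honest behaviour (`exists_purification`).
Each remains a legitimate cheater against the honest other, so both security conditions apply to one
final pure state. Security against Bob says that his final system, given Alice's strings, hides the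
XOR. Security against Alice says that her reduced state does not depend on Bob's index. Hence
steering lets Bob choose any index `c` afterwards and measure `w` as if `c` had come up, which gives
`D c` with the right statistics.

Optimal measurements exist by compactness. If the optimum exceeds `p`, mixing in a flagged useless
state lowers it continuously towards `1 / 2 ^ n`, which settles the first list. -/

set_option linter.unusedSectionVars false
set_option linter.unusedDecidableInType false
set_option linter.unusedFintypeInType false
set_option synthInstance.maxSize 600

/-! ### Positive matrices, steering and state discrimination -/

section LinearAlgebra

variable {H X K : Type} [Fintype H] [DecidableEq H] [Fintype X] [DecidableEq X]
  [Fintype K]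

theorem Matrix.PosSemidef.exists_eq_mul_conjTranspose {σ : Matrix H H ℂ} (hσ : σ.PosSemidef) :
    ∃ C : Matrix H H ℂ, σ = C * Cᴴ := by
  have h := hσ.isHermitian.spectral_theorem
  refine ⟨(hσ.isHermitian.eigenvectorUnitary : Matrix H H ℂ) *
    Matrix.diagonal (fun i => ((√(hσ.isHermitian.eigenvalues i) : ℝ) : ℂ)), ?_⟩
  conv_lhs => rw [h]
  rw [Unitary.conjStarAlgAut_apply, Matrix.conjTranspose_mul, Matrix.diagonal_conjTranspose,
    Matrix.star_eq_conjTranspose, Matrix.mul_assoc, Matrix.mul_assoc,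
    ← Matrix.mul_assoc (Matrix.diagonal _) (Matrix.diagonal _), Matrix.diagonal_mul_diagonal]
  congr 3
  ext i
  simp [← Complex.ofReal_mul, Real.mul_self_sqrt (hσ.eigenvalues_nonneg i)]

theorem Matrix.PosSemidef.mul_eq_zero_of_conj_eq_zero {τ : Matrix H H ℂ} (hτ : τ.PosSemidef)
    {L : Matrix X H ℂ} (h : L * τ * Lᴴ = 0) : L * τ = 0 := by
  obtain ⟨B, rfl⟩ := hτ.exists_eq_mul_conjTranspose
  have : L * B * (L * B)ᴴ = 0 := by
    rw [Matrix.conjTranspose_mul, ← h]; simp only [Matrix.mul_assoc]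
  rw [Matrix.self_mul_conjTranspose_eq_zero] at this
  rw [← Matrix.mul_assoc, this, Matrix.zero_mul]

theorem Matrix.eq_zero_of_sum_eq_zero_of_posSemidef {τ : K → Matrix H H ℂ}
    (hτ : ∀ k, (τ k).PosSemidef) (h : ∑ k, τ k = 0) (k : K) : τ k = 0 := by
  rw [← (hτ k).trace_eq_zero_iff]
  have h' : ∑ k, (τ k).trace = 0 := by rw [← Matrix.trace_sum, h, Matrix.trace_zero]
  exact (Finset.sum_eq_zero_iff_of_nonneg (fun k _ => (hτ k).trace_nonneg)).1 h' k
    (Finset.mem_univ k)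

/-- A Hermitian matrix has a Hermitian generalized inverse. -/
theorem Matrix.IsHermitian.exists_pseudoinverse {σ : Matrix H H ℂ} (hσ : σ.IsHermitian) :
    ∃ P : Matrix H H ℂ, P.IsHermitian ∧ σ * P * σ = σ ∧ P * σ * P = P := by
  set U : Matrix H H ℂ := (hσ.eigenvectorUnitary : Matrix H H ℂ) with hU
  set d : H → ℂ := fun i => (hσ.eigenvalues i : ℂ) with hd
  have hσU : σ = U * Matrix.diagonal d * Uᴴ := by
    have h := hσ.spectral_theorem
    rw [Unitary.conjStarAlgAut_apply, Matrix.star_eq_conjTranspose] at h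
    exact h
  have hUU : Uᴴ * U = 1 := by
    rw [← Matrix.star_eq_conjTranspose]; simp [hU]
  have key : ∀ x y : H → ℂ, (U * Matrix.diagonal x * Uᴴ) * (U * Matrix.diagonal y * Uᴴ) =
      U * Matrix.diagonal (fun i => x i * y i) * Uᴴ := by
    intro x y
    calc _ = U * Matrix.diagonal x * (Uᴴ * U) * Matrix.diagonal y * Uᴴ := by
          simp only [Matrix.mul_assoc]
      _ = _ := by
          rw [hUU, Matrix.mul_one, Matrix.mul_assoc U, Matrix.diagonal_mul_diagonal]
  -- Since `0⁻¹ = 0`, only the nonzero eigenvalues are inverted.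
  refine ⟨U * Matrix.diagonal (fun i => (d i)⁻¹) * Uᴴ, ?_, ?_, ?_⟩
  · rw [Matrix.IsHermitian, Matrix.conjTranspose_mul, Matrix.conjTranspose_mul,
      Matrix.conjTranspose_conjTranspose, Matrix.diagonal_conjTranspose, Matrix.mul_assoc]
    congr 3
    ext i
    simp [hd]
  · rw [hσU, key, key]
    congr 3
    ext i
    exact mul_inv_mul_cancel (d i)
  · rw [hσU, key, key]
    congr 3
    ext i
    simpa using mul_inv_mul_cancel (d i)⁻¹

/-- Steering: every decomposition of the reduced state `C * Cᴴ` is induced by a measurement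
of the purifying system. -/
theorem exists_isPOVM_steering [Nonempty K] (C : Matrix X H ℂ) (τ : K → Matrix X X ℂ)
    (hτ : ∀ k, (τ k).PosSemidef) (hsum : ∑ k, τ k = C * Cᴴ) :
    ∃ E : K → Matrix H H ℂ, IsPOVM E ∧ ∀ k, C * E k * Cᴴ = τ k := by
  classical
  set σ := C * Cᴴ with hσ
  have hσH : σ.IsHermitian := (Matrix.posSemidef_self_mul_conjTranspose C).isHermitian
  obtain ⟨P, hP, h1, h2⟩ := hσH.exists_pseudoinverse
  have hPH : Pᴴ = P := hP
  have hτσ : ∀ k, σ * P * τ k = τ k := by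
    intro k
    -- Each `τ k` is a positive summand of `σ`, so whatever annihilates `σ` in this way annihilates
    -- `τ k`: its range lies in that of `σ`.
    have h0 : (1 - σ * P) * σ * (1 - σ * P)ᴴ = 0 := by
      have : (1 - σ * P) * σ = 0 := by
        rw [Matrix.sub_mul, Matrix.one_mul, h1, sub_self]
      rw [this, Matrix.zero_mul]
    rw [← hsum, Matrix.mul_sum, Matrix.sum_mul] at h0
    have h3 := Matrix.eq_zero_of_sum_eq_zero_of_posSemidef
      (fun k => (hτ k).mul_mul_conjTranspose_same _) h0 k
    have h4 := (hτ k).mul_eq_zero_of_conj_eq_zero h3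
    rw [hsum, Matrix.sub_mul, Matrix.one_mul, sub_eq_zero] at h4
    exact h4.symm
  have hτσ' : ∀ k, τ k * P * σ = τ k := by
    intro k
    have := congrArg Matrix.conjTranspose (hτσ k)
    rwa [Matrix.conjTranspose_mul, Matrix.conjTranspose_mul, hPH, hσH.eq,
      (hτ k).isHermitian.eq, ← Matrix.mul_assoc] at this
  set Q : Matrix H H ℂ := Cᴴ * P * C with hQ
  have hQH : Qᴴ = Q := by
    simp only [hQ, Matrix.conjTranspose_mul, Matrix.conjTranspose_conjTranspose, hPH,
      Matrix.mul_assoc]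
  have hQQ : Q * Q = Q := by
    calc Q * Q = Cᴴ * (P * (C * Cᴴ) * P) * C := by simp only [hQ, Matrix.mul_assoc]
      _ = Q := by rw [← hσ, h2]
  have hQ' : (1 - Q).PosSemidef := by
    have : (1 - Q) = (1 - Q) * (1 - Q)ᴴ := by
      rw [Matrix.conjTranspose_sub, Matrix.conjTranspose_one, hQH, Matrix.sub_mul,
        Matrix.mul_sub, Matrix.mul_sub, hQQ]
      simp
    rw [this]
    exact Matrix.posSemidef_self_mul_conjTranspose _
  have hCQ : C * (1 - Q) * Cᴴ = 0 := by
    calc _ = C * Cᴴ - C * Cᴴ * P * (C * Cᴴ) := by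
          simp only [hQ, Matrix.mul_sub, Matrix.sub_mul, Matrix.mul_one, Matrix.mul_assoc]
      _ = 0 := by rw [← hσ, h1, sub_self]
  let k₀ : K := Classical.arbitrary K
  -- The main terms add up only to the projection `Q`. The missing `1 - Q` may go to any outcome,
  -- because `C` does not see it (`hCQ`).
  refine ⟨fun k => Cᴴ * P * τ k * (Cᴴ * P)ᴴ + if k = k₀ then 1 - Q else 0, ⟨?_, ?_⟩, ?_⟩
  · intro k
    refine ((hτ k).mul_mul_conjTranspose_same _).add ?_
    split_ifs
    · exact hQ'
    · exact Matrix.PosSemidef.zero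
  · rw [Finset.sum_add_distrib, ← Matrix.sum_mul, ← Matrix.mul_sum, hsum]
    have : Cᴴ * P * σ * (Cᴴ * P)ᴴ = Q := by
      calc _ = Cᴴ * (P * σ * P) * C := by
            simp only [Matrix.conjTranspose_mul, Matrix.conjTranspose_conjTranspose, hPH,
              Matrix.mul_assoc]
        _ = Q := by rw [h2]
    rw [this]; simp
  · intro k
    have h5 : C * (Cᴴ * P * τ k * (Cᴴ * P)ᴴ) * Cᴴ = τ k := by
      calc _ = (C * Cᴴ) * P * τ k * P * (C * Cᴴ) := by
            simp only [Matrix.conjTranspose_mul, Matrix.conjTranspose_conjTranspose, hPH,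
              Matrix.mul_assoc]
        _ = τ k := by rw [← hσ, hτσ, hτσ']
    rw [Matrix.mul_add, Matrix.add_mul, h5]
    split_ifs
    · rw [hCQ, add_zero]
    · simp

theorem isPOVM_single [DecidableEq K] (k : K) :
    IsPOVM (Pi.single k (1 : Matrix H H ℂ) : K → Matrix H H ℂ) := by
  refine ⟨fun j => ?_, by simp⟩
  by_cases h : j = k
  · subst h; simpa using Matrix.PosSemidef.one
  · simpa [h] using Matrix.PosSemidef.zero

/-- If the success probability of telling apart a family of states does not depend on the
measurement, then the states are all equal. -/
theorem eq_of_trace_povm_const {σ : K → Matrix H H ℂ} (hσ : ∀ k, (σ k).IsHermitian) {c : ℝ}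
    (h : ∀ G : K → Matrix H H ℂ, IsPOVM G → ∑ k, ((G k * σ k).trace).re = c) (k l : K) :
    σ k = σ l := by
  classical
  by_contra hne
  have hkl : k ≠ l := fun h => hne (by rw [h])
  have hΔ : (σ k - σ l).IsHermitian := (hσ k).sub (hσ l)
  obtain ⟨v, t, ht, hv, hvt⟩ := hΔ.exists_eigenvector_of_ne_zero (sub_ne_zero.2 hne)
  set a : ℂ := star v ⬝ᵥ v with ha
  have ha0 : a ≠ 0 := by simpa [ha] using hv
  have hastar : star a = a := by
    simp [ha, dotProduct, mul_comm]
  -- The projection onto an eigenvector of `σ k - σ l` with eigenvalue `t ≠ 0`. Answering `k` on `P`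
  -- and `l` otherwise, instead of always `l`, changes the success probability by `t`.
  set P : Matrix H H ℂ := a⁻¹ • Matrix.vecMulVec v (star v) with hP
  have hPH : Pᴴ = P := by
    rw [hP, Matrix.conjTranspose_smul, Matrix.conjTranspose_vecMulVec, star_star, star_inv₀,
      hastar]
  have hPP : P * P = P := by
    rw [hP, Matrix.smul_mul, Matrix.mul_smul, Matrix.vecMulVec_mul_vecMulVec, ← ha,
      Matrix.vecMulVec_smul, smul_smul, smul_smul, mul_assoc,
      inv_mul_cancel₀ ha0, mul_one]
  have psd : P.PosSemidef := by
    have : P = P * Pᴴ := by rw [hPH, hPP]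
    rw [this]; exact Matrix.posSemidef_self_mul_conjTranspose _
  have psd' : (1 - P).PosSemidef := by
    have : (1 - P) = (1 - P) * (1 - P)ᴴ := by
      rw [Matrix.conjTranspose_sub, Matrix.conjTranspose_one, hPH, Matrix.sub_mul,
        Matrix.mul_sub, Matrix.mul_sub, hPP]
      simp
    rw [this]; exact Matrix.posSemidef_self_mul_conjTranspose _
  have h1 := h _ (isPOVM_single l)
  have h2 := h (Pi.single k P + Pi.single l (1 - P)) ⟨fun j => by
    rw [Pi.add_apply]
    refine Matrix.PosSemidef.add ?_ ?_
    · by_cases hj : j = k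
      · subst hj; simpa using psd
      · simpa [hj] using Matrix.PosSemidef.zero
    · by_cases hj : j = l
      · subst hj; simpa using psd'
      · simpa [hj] using Matrix.PosSemidef.zero, by simp [Finset.sum_add_distrib]⟩
  rw [← h1] at h2
  have e1 : ∀ (k : K) (P : Matrix H H ℂ),
      ∑ j, (((Pi.single k P : K → Matrix H H ℂ) j * σ j).trace).re = ((P * σ k).trace).re := by
    intro k P
    rw [Finset.sum_eq_single k]
    · simp
    · intro j _ hj; simp [hj]
    · simp
  simp only [Pi.add_apply, Matrix.add_mul, Matrix.trace_add, Complex.add_re,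
    Finset.sum_add_distrib, e1, Matrix.sub_mul, Matrix.one_mul, Matrix.trace_sub,
    Complex.sub_re] at h2
  have h3 : ((P * (σ k - σ l)).trace).re = 0 := by
    rw [Matrix.mul_sub, Matrix.trace_sub, Complex.sub_re]; linarith
  have h4 : (P * (σ k - σ l)).trace = t := by
    rw [hP, Matrix.trace_mul_comm, Matrix.mul_smul, Matrix.mul_vecMulVec, hvt, Matrix.trace_smul,
      Matrix.trace_vecMulVec, smul_dotProduct, dotProduct_comm, ← ha]
    simp only [smul_eq_mul, Complex.real_smul]
    field_simp
  rw [h4] at h3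
  exact ht (by simpa using h3)

end LinearAlgebra

/-! ### Bit strings, mixed strings and their sums -/

section Bits

variable {n : ℕ}

theorem Bits.add_self (x : Bits n) : x + x = 0 :=
  funext fun _ => CharTwo.add_self_eq_zero _

theorem Bits.add_add_cancel_left (x y : Bits n) : x + (x + y) = y := by
  rw [← add_assoc, Bits.add_self, zero_add]

theorem Bits.card : Fintype.card (Bits n) = 2 ^ n := by
  simp [Bits, ZMod.card]

theorem Bits.sum_const (c : ℝ) : ∑ _x : Bits n, c = 2 ^ n * c := by
  rw [Finset.sum_const, Finset.card_univ, Bits.card, nsmul_eq_mul]; norm_cast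

theorem Bits.sum_add_left {V : Type*} [AddCommMonoid V] (t : Bits n) (f : Bits n → V) :
    ∑ s, f (t + s) = ∑ s, f s :=
  Equiv.sum_comp (Equiv.addLeft t) f

theorem Bits.sum_add_right {V : Type*} [AddCommMonoid V] (t : Bits n) (f : Bits n → V) :
    ∑ s, f (s + t) = ∑ s, f s :=
  Equiv.sum_comp (Equiv.addRight t) f

/-- Summing over pairs of strings is summing over one string and the XOR. -/
theorem Bits.sum_pair_eq {V : Type*} [AddCommMonoid V] (f : Bits n → Bits n → V) :
    ∑ x₀, ∑ x₁, f x₀ x₁ = ∑ s, ∑ x₀, f x₀ (x₀ + s) := by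
  rw [Finset.sum_comm (γ := Bits n)]
  rw [Finset.sum_comm (f := fun s x₀ => f x₀ (x₀ + s))]
  rw [Finset.sum_comm]
  exact Finset.sum_congr rfl fun x₀ _ => (Bits.sum_add_left x₀ _).symm

/-- This is what allows Bob to remove the pad from the outcome of his measurement. -/
theorem mix_add_left (c r x₀ x₁ : Bits n) : mix c (x₀ + r) (x₁ + r) = mix c x₀ x₁ + r := by
  funext i
  by_cases h : c i = 0 <;> simp [mix, h]

/-- Bitwise, `b = a + x * y` selects `a` or `a + x` according to `y`: CHSH is the task of decoding a
mixed string of a pair whose XOR is Alice's question. -/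
theorem eq_mix_iff (x y a b : Bits n) :
    (∀ i, a i + b i = x i * y i) ↔ b = mix y a (a + x) := by
  rw [funext_iff]
  refine forall_congr' fun i => ?_
  simp only [mix, Pi.add_apply]
  generalize a i = a; generalize b i = b; generalize x i = x; generalize y i = y
  revert a b x y
  decide

/-- For a fixed XOR, the mixed string is a translate of `x₀`, hence takes every value once. -/
theorem Bits.sum_mix {V : Type*} [AddCommMonoid V] (c : Bits n) (f : Bits n → V) :
    ∑ x₀, ∑ x₁, f (mix c x₀ x₁) = 2 ^ n • ∑ s, f s := by
  rw [Bits.sum_pair_eq]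
  have : ∀ s x₀ : Bits n, mix c x₀ (x₀ + s) = mix c 0 s + x₀ := by
    intro s x₀
    rw [← mix_add_left, zero_add, add_comm x₀ s]
  simp only [this]
  have h2 : ∀ s : Bits n, ∑ x₀, f (mix c 0 s + x₀) = ∑ x₀, f x₀ := fun s =>
    Bits.sum_add_left _ f
  simp only [h2]
  rw [Finset.sum_const, Finset.card_univ, Bits.card]

theorem Bits.sum_xor {V : Type*} [AddCommMonoid V] (f : Bits n → V) :
    ∑ x₀ : Bits n, ∑ x₁ : Bits n, f (x₀ + x₁) = 2 ^ n • ∑ s, f s := by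
  have : ∀ x₀ : Bits n, ∑ x₁, f (x₀ + x₁) = ∑ x₁, f x₁ := fun x₀ => Bits.sum_add_left _ f
  simp only [this]
  rw [Finset.sum_const, Finset.card_univ, Bits.card]

end Bits

/-! ### Existence of optimal measurements -/

section POVM

variable {K H : Type} [Fintype K] [Fintype H] [DecidableEq H]

theorem isPOVM_conjTranspose_mul_self {Y : K → Matrix H H ℂ} (h : ∑ k, (Y k)ᴴ * Y k = 1) :
    IsPOVM fun k => (Y k)ᴴ * Y k :=
  ⟨fun _ => Matrix.posSemidef_conjTranspose_mul_self _, h⟩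

theorem IsPOVM.exists_eq {E : K → Matrix H H ℂ} (hE : IsPOVM E) :
    ∃ Y : K → Matrix H H ℂ, (∀ k, E k = (Y k)ᴴ * Y k) ∧ ∑ k, (Y k)ᴴ * Y k = 1 := by
  choose C hC using fun k => (hE.posSemidef k).exists_eq_mul_conjTranspose
  refine ⟨fun k => (C k)ᴴ, fun k => by rw [Matrix.conjTranspose_conjTranspose, ← hC], ?_⟩
  rw [← hE.sum_eq_one]
  exact Finset.sum_congr rfl fun k _ => by rw [Matrix.conjTranspose_conjTranspose, ← hC]

/-- Writing effects as `Yᴴ * Y` exhibits the measurements as a continuous image of this set. It is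
closed, and the diagonal entries of the equation bound all entries of `Y` by `1`. -/
theorem isCompact_kraus_families :
    IsCompact {Y : K → H → H → ℂ |
      ∑ k, (Matrix.of (Y k))ᴴ * Matrix.of (Y k) = (1 : Matrix H H ℂ)} := by
  have hc : Continuous fun Y : K → H → H → ℂ => ∑ k, (Matrix.of (Y k))ᴴ * Matrix.of (Y k) := by
    refine continuous_finsetSum _ fun k _ => ?_
    have : Continuous fun Y : K → H → H → ℂ => (Matrix.of (Y k) : Matrix H H ℂ) :=
      continuous_apply k
    exact this.matrix_conjTranspose.matrix_mul this
  refine IsCompact.of_isClosed_subset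
    (isCompact_univ_pi fun _ : K => isCompact_univ_pi fun _ : H => isCompact_univ_pi fun _ : H =>
      isCompact_closedBall (0 : ℂ) 1) (isClosed_singleton.preimage hc) ?_
  intro Y hY
  simp only [Set.mem_univ_pi, mem_closedBall_zero_iff]
  intro k i j
  have h1 : ∑ k, ∑ i, ‖Y k i j‖ ^ 2 = (1 : ℝ) := by
    have := congrFun (congrFun (Set.mem_ofPred_eq ▸ hY) j) j
    simp only [Matrix.sum_apply, Matrix.mul_apply, Matrix.conjTranspose_apply, Matrix.of_apply,
      Matrix.one_apply_eq] at this
    have h2 : ∀ z : ℂ, star z * z = ((‖z‖ ^ 2 : ℝ) : ℂ) := fun z => by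
      rw [Complex.star_def, Complex.conj_mul']; norm_cast
    simp only [h2] at this
    exact_mod_cast this
  have h3 : ‖Y k i j‖ ^ 2 ≤ 1 := by
    rw [← h1]
    exact (Finset.single_le_sum (f := fun i => ‖Y k i j‖ ^ 2) (fun _ _ => sq_nonneg _)
      (Finset.mem_univ i)).trans
      (Finset.single_le_sum (f := fun k => ∑ i, ‖Y k i j‖ ^ 2)
        (fun _ _ => Finset.sum_nonneg fun _ _ => sq_nonneg _) (Finset.mem_univ k))
  exact (sq_le_one_iff₀ (norm_nonneg _)).1 h3

/-- A continuous function of a measurement has a maximum. -/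
theorem exists_isPOVM_forall_le [Nonempty K] {F : (K → Matrix H H ℂ) → ℝ} (hF : Continuous F) :
    ∃ E, IsPOVM E ∧ ∀ E', IsPOVM E' → F E' ≤ F E := by
  classical
  obtain ⟨Y, hY, hmax⟩ := (isCompact_kraus_families (K := K) (H := H)).exists_isMaxOn
    (f := fun Y => F fun k => (Matrix.of (Y k))ᴴ * Matrix.of (Y k)) (by
      obtain ⟨Y, -, hY⟩ := (isPOVM_single (H := H) (Classical.arbitrary K)).exists_eq
      exact ⟨Y, hY⟩) (by
      refine (hF.comp (continuous_pi fun k => ?_)).continuousOn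
      have : Continuous fun Y : K → H → H → ℂ => (Matrix.of (Y k) : Matrix H H ℂ) :=
        continuous_apply k
      exact this.matrix_conjTranspose.matrix_mul this)
  refine ⟨_, isPOVM_conjTranspose_mul_self hY, fun E' hE' => ?_⟩
  obtain ⟨Y', h1, h2⟩ := hE'.exists_eq
  rw [show E' = fun k => (Y' k)ᴴ * Y' k from funext h1]
  exact hmax h2

end POVM

/-! ### Learning probabilities and hidden XOR -/

namespace Encoding

variable {n : ℕ} (e : Encoding n) (f : Bits n → Bits n → Bits n)

theorem continuous_decodeProb : Continuous (e.decodeProb f) := by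
  unfold decodeProb
  refine continuous_finsetSum _ fun x₀ _ => continuous_finsetSum _ fun x₁ _ =>
    continuous_const.mul (Complex.continuous_re.comp ?_)
  exact ((continuous_apply (f x₀ x₁)).matrix_mul continuous_const).matrix_trace

theorem exists_isPOVM_learnProb_eq :
    ∃ E, IsPOVM E ∧ e.learnProb f = e.decodeProb f E ∧
      ∀ E', IsPOVM E' → e.decodeProb f E' ≤ e.decodeProb f E := by
  obtain ⟨E, hE, hmax⟩ := exists_isPOVM_forall_le (e.continuous_decodeProb f)
  refine ⟨E, hE, ?_, hmax⟩
  have : Nonempty {E : Bits n → Matrix e.H e.H ℂ // IsPOVM E} := ⟨⟨E, hE⟩⟩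
  refine le_antisymm (ciSup_le fun E' => hmax _ E'.2) ?_
  exact le_ciSup (f := fun E : {E : Bits n → Matrix e.H e.H ℂ // IsPOVM E} =>
    e.decodeProb f E.1) ⟨_, by rintro _ ⟨E', rfl⟩; exact hmax _ E'.2⟩ ⟨E, hE⟩

theorem decodeProb_le_learnProb {E : Bits n → Matrix e.H e.H ℂ} (hE : IsPOVM E) :
    e.decodeProb f E ≤ e.learnProb f := by
  obtain ⟨E', _, h, hmax⟩ := e.exists_isPOVM_learnProb_eq f
  rw [h]
  exact hmax _ hE

variable {e} in
theorem hidesXor_of_forall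
    (h : ∀ E, IsPOVM E → e.decodeProb (fun x₀ x₁ => x₀ + x₁) E = 1 / 2 ^ n) : e.HidesXor := by
  obtain ⟨E, hE, h', -⟩ := e.exists_isPOVM_learnProb_eq fun x₀ x₁ => x₀ + x₁
  rw [HidesXor, h', h E hE]

/-- The (subnormalized) state of the system given that the XOR is `s`. -/
noncomputable def xorState (s : Bits n) : Matrix e.H e.H ℂ :=
  ∑ x₀, (e.prior x₀ (x₀ + s) : ℂ) • e.state x₀ (x₀ + s)

theorem posSemidef_smul_state (x₀ x₁ : Bits n) :
    ((e.prior x₀ x₁ : ℂ) • e.state x₀ x₁).PosSemidef :=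
  (e.isDensity x₀ x₁).posSemidef.smul (by exact_mod_cast e.prior_nonneg x₀ x₁)

theorem posSemidef_xorState (s : Bits n) : (e.xorState s).PosSemidef :=
  Matrix.posSemidef_sum _ fun _ _ => e.posSemidef_smul_state _ _

theorem trace_xorState (s : Bits n) : (e.xorState s).trace = ∑ x₀, (e.prior x₀ (x₀ + s) : ℂ) := by
  simp [xorState, Matrix.trace_sum, (e.isDensity _ _).trace_eq_one]

theorem decodeProb_xor (E : Bits n → Matrix e.H e.H ℂ) :
    e.decodeProb (fun x₀ x₁ => x₀ + x₁) E = ∑ s, ((E s * e.xorState s).trace).re := by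
  unfold decodeProb xorState
  rw [Bits.sum_pair_eq]
  refine Finset.sum_congr rfl fun s _ => ?_
  rw [Matrix.mul_sum, Matrix.trace_sum, Complex.re_sum]
  refine Finset.sum_congr rfl fun x₀ _ => ?_
  beta_reduce
  rw [Bits.add_add_cancel_left, Matrix.mul_smul, Matrix.trace_smul, smul_eq_mul,
    Complex.re_ofReal_mul]

variable {e}

theorem sum_trace_xorState : ∑ s, ((e.xorState s).trace).re = 1 := by
  rw [← e.prior_sum, Bits.sum_pair_eq]
  refine Finset.sum_congr rfl fun s _ => ?_
  rw [trace_xorState]; simp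

/-- Relabelling the outcomes by a shift `t` gives `2 ^ n` measurements whose success probabilities
sum to `1`. None exceeds `1 / 2 ^ n`, so all are equal to it; `t = 0` is the claim. -/
theorem HidesXor.decodeProb_eq (h : e.HidesXor) {E : Bits n → Matrix e.H e.H ℂ}
    (hE : IsPOVM E) : e.decodeProb (fun x₀ x₁ => x₀ + x₁) E = 1 / 2 ^ n := by
  have hsh : ∀ t, IsPOVM fun s => E (s + t) := fun t =>
    ⟨fun s => hE.posSemidef _, by rw [Bits.sum_add_right t E, hE.sum_eq_one]⟩
  have hle : ∀ t, e.decodeProb (fun x₀ x₁ => x₀ + x₁) (fun s => E (s + t)) ≤ 1 / 2 ^ n :=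
    fun t => h ▸ e.decodeProb_le_learnProb _ (hsh t)
  have hsum : ∑ t, e.decodeProb (fun x₀ x₁ => x₀ + x₁) (fun s => E (s + t)) =
      ∑ _t : Bits n, (1 / 2 ^ n : ℝ) := by
    rw [Bits.sum_const, mul_one_div_cancel (by positivity), ← sum_trace_xorState (e := e)]
    simp only [decodeProb_xor]
    rw [Finset.sum_comm]
    refine Finset.sum_congr rfl fun s _ => ?_
    rw [← Complex.re_sum, ← Matrix.trace_sum, ← Matrix.sum_mul, Bits.sum_add_left s E,
      hE.sum_eq_one, Matrix.one_mul]
  have := (Finset.sum_eq_sum_iff_of_le fun t _ => hle t).1 hsum 0 (Finset.mem_univ _)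
  simpa using this

/-- The operator form of hiding, needed for steering as well as for security against Bob. -/
theorem HidesXor.xorState_eq (h : e.HidesXor) (s t : Bits n) : e.xorState s = e.xorState t :=
  eq_of_trace_povm_const (fun s => (e.posSemidef_xorState s).isHermitian)
    (fun G hG => by rw [← decodeProb_xor, h.decodeProb_eq hG]) s t

theorem HidesXor.trace_xorState (h : e.HidesXor) (s : Bits n) :
    (e.xorState s).trace = 1 / 2 ^ n := by
  have h1 := sum_trace_xorState (e := e)
  simp only [fun t => h.xorState_eq t s, Bits.sum_const] at h1
  have h2 : ((e.xorState s).trace).re = 1 / 2 ^ n := by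
    rw [eq_div_iff (by positivity), mul_comm]; exact h1
  have h3 : (e.xorState s).trace = (((e.xorState s).trace).re : ℂ) := by
    rw [Encoding.trace_xorState]; simp
  rw [h3, h2]; push_cast; rfl

end Encoding

/-! ### Lowering the learning probability by dilution -/

section POVM

variable {K H H' : Type} [Fintype K] [Fintype H] [DecidableEq H] [Fintype H'] [DecidableEq H']

theorem IsPOVM.conj {E : K → Matrix H' H' ℂ} (hE : IsPOVM E) {V : Matrix H' H ℂ}
    (hV : Vᴴ * V = 1) : IsPOVM fun k => Vᴴ * E k * V :=
  ⟨fun k => (hE.posSemidef k).conjTranspose_mul_mul_same V, by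
    rw [← Matrix.sum_mul, ← Matrix.mul_sum, hE.sum_eq_one, Matrix.mul_one, hV]⟩

end POVM

namespace Encoding

variable {n : ℕ} (e : Encoding n)

/-- The inclusion of the system into its direct sum with a one-dimensional one. -/
def inclLeft : Matrix (e.H ⊕ Unit) e.H ℂ := Matrix.fromRows 1 0

/-- The inclusion of the additional basis state. -/
def inclRight : Matrix (e.H ⊕ Unit) Unit ℂ := Matrix.fromRows 0 1

theorem inclLeft_isometry : e.inclLeftᴴ * e.inclLeft = 1 := by
  simp [inclLeft, Matrix.conjTranspose_fromRows_eq_fromCols_conjTranspose,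
    Matrix.fromCols_mul_fromRows]

theorem inclRight_isometry : e.inclRightᴴ * e.inclRight = 1 := by
  simp [inclRight, Matrix.conjTranspose_fromRows_eq_fromCols_conjTranspose,
    Matrix.fromCols_mul_fromRows]

theorem inclLeft_mul_inclRight : e.inclLeftᴴ * e.inclRight = 0 := by
  simp [inclLeft, inclRight, Matrix.conjTranspose_fromRows_eq_fromCols_conjTranspose,
    Matrix.fromCols_mul_fromRows]

theorem incl_complete :
    e.inclLeft * e.inclLeftᴴ + e.inclRight * e.inclRightᴴ = 1 := by
  simp [inclLeft, inclRight, Matrix.conjTranspose_fromRows_eq_fromCols_conjTranspose]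
  ext (i | i) (j | j) <;> simp [Matrix.one_apply]

/-- The prior of `dilute`. -/
noncomputable def dilutePrior (l : ℝ) (x₀ x₁ : Bits n) : ℝ :=
  l * e.prior x₀ x₁ + (1 - l) * (1 / 2 ^ n * (1 / 2 ^ n))

/-- Positivity comes from the uniform branch, hence `l < 1`. It permits division by this prior: the
coefficients in `dilute` are the posterior weights of the two branches. -/
theorem dilutePrior_pos {l : ℝ} (h0 : 0 ≤ l) (h1 : l < 1) (x₀ x₁ : Bits n) :
    0 < e.dilutePrior l x₀ x₁ := by
  have h2 := e.prior_nonneg x₀ x₁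
  have h3 : 0 < 1 - l := by linarith
  unfold dilutePrior
  positivity

/-- The encoding `e` with probability `l`, and otherwise uniformly random strings together with
a state that says nothing but that this is the case. -/
noncomputable def dilute (l : ℝ) (h0 : 0 ≤ l) (h1 : l < 1) : Encoding n where
  H := e.H ⊕ Unit
  prior := e.dilutePrior l
  prior_nonneg x₀ x₁ := (e.dilutePrior_pos h0 h1 x₀ x₁).le
  prior_sum := by
    simp only [dilutePrior, Finset.sum_add_distrib, ← Finset.mul_sum, e.prior_sum,
      Bits.sum_const]
    field_simp
    ring
  state x₀ x₁ := ((l * e.prior x₀ x₁ / e.dilutePrior l x₀ x₁ : ℝ) : ℂ) •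
      (e.inclLeft * e.state x₀ x₁ * e.inclLeftᴴ) +
    (((1 - l) * (1 / 2 ^ n * (1 / 2 ^ n)) / e.dilutePrior l x₀ x₁ : ℝ) : ℂ) •
      (e.inclRight * e.inclRightᴴ)
  isDensity x₀ x₁ := by
    have hp := e.dilutePrior_pos h0 h1 x₀ x₁
    have h2 := e.prior_nonneg x₀ x₁
    have h3 : 0 < 1 - l := by linarith
    refine ⟨Matrix.PosSemidef.add ?_ ?_, ?_⟩
    · exact ((e.isDensity x₀ x₁).posSemidef.mul_mul_conjTranspose_same _).smul
        (Complex.zero_le_real.2 (by positivity))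
    · exact (Matrix.posSemidef_self_mul_conjTranspose _).smul
        (Complex.zero_le_real.2 (by positivity))
    · rw [Matrix.trace_add, Matrix.trace_smul, Matrix.trace_smul,
        Matrix.trace_mul_comm (_ * _), ← Matrix.mul_assoc, e.inclLeft_isometry, Matrix.one_mul,
        (e.isDensity x₀ x₁).trace_eq_one, Matrix.trace_mul_comm, e.inclRight_isometry]
      simp only [Matrix.trace_one, Fintype.card_unit, Nat.cast_one, smul_eq_mul, mul_one]
      rw [← Complex.ofReal_add, ← add_div, ← dilutePrior, div_self hp.ne', Complex.ofReal_one]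

/-- The hypothesis `hf` says that `f` is uniform on uniform pairs, so in the useless branch every
measurement succeeds with probability `1 / 2 ^ n`. -/
theorem decodeProb_dilute {l : ℝ} (h0 : 0 ≤ l) (h1 : l < 1) (f : Bits n → Bits n → Bits n)
    (hf : ∀ g : Bits n → ℝ, ∑ x₀, ∑ x₁, g (f x₀ x₁) = 2 ^ n * ∑ s, g s)
    {E : Bits n → Matrix (e.H ⊕ Unit) (e.H ⊕ Unit) ℂ} (hE : IsPOVM E) :
    (e.dilute l h0 h1).decodeProb f E =
      l * e.decodeProb f (fun s => e.inclLeftᴴ * E s * e.inclLeft) + (1 - l) * (1 / 2 ^ n) := by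
  have h2 : ∑ s, ((e.inclRightᴴ * E s * e.inclRight).trace).re = 1 := by
    rw [← Complex.re_sum, ← Matrix.trace_sum, (hE.conj e.inclRight_isometry).sum_eq_one]
    simp
  have h3 := hf fun s => ((e.inclRightᴴ * E s * e.inclRight).trace).re
  rw [h2, mul_one] at h3
  have h4 : (1 - l) * (1 / 2 ^ n) = (1 - l) * (1 / 2 ^ n * (1 / 2 ^ n)) *
      ∑ x₀, ∑ x₁, ((e.inclRightᴴ * E (f x₀ x₁) * e.inclRight).trace).re := by
    rw [h3]; field_simp
  rw [h4]
  unfold decodeProb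
  simp only [Finset.mul_sum, ← Finset.sum_add_distrib]
  refine Finset.sum_congr rfl fun x₀ _ => Finset.sum_congr rfl fun x₁ _ => ?_
  have hp := e.dilutePrior_pos h0 h1 x₀ x₁
  have t1 : (E (f x₀ x₁) * (e.inclLeft * e.state x₀ x₁ * e.inclLeftᴴ)).trace =
      (e.inclLeftᴴ * E (f x₀ x₁) * e.inclLeft * e.state x₀ x₁).trace := by
    rw [← Matrix.mul_assoc, Matrix.trace_mul_comm]
    simp only [Matrix.mul_assoc]
  have t2 : (E (f x₀ x₁) * (e.inclRight * e.inclRightᴴ)).trace =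
      (e.inclRightᴴ * E (f x₀ x₁) * e.inclRight).trace := by
    rw [← Matrix.mul_assoc, Matrix.trace_mul_comm, Matrix.mul_assoc]
  have t3 : ∀ a b : ℝ, ((E (f x₀ x₁) *
      ((a : ℂ) • (e.inclLeft * e.state x₀ x₁ * e.inclLeftᴴ) +
        (b : ℂ) • (e.inclRight * e.inclRightᴴ))).trace).re =
      a * ((e.inclLeftᴴ * E (f x₀ x₁) * e.inclLeft * e.state x₀ x₁).trace).re +
        b * ((e.inclRightᴴ * E (f x₀ x₁) * e.inclRight).trace).re := by
    intro a b
    rw [Matrix.mul_add, Matrix.mul_smul, Matrix.mul_smul, Matrix.trace_add, Matrix.trace_smul,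
      Matrix.trace_smul, Complex.add_re, smul_eq_mul, smul_eq_mul, Complex.re_ofReal_mul,
      Complex.re_ofReal_mul, t1, t2]
  refine (congrArg (e.dilutePrior l x₀ x₁ * ·) (t3 _ _)).trans ?_
  field_simp

theorem learnProb_dilute {l : ℝ} (h0 : 0 ≤ l) (h1 : l < 1) (f : Bits n → Bits n → Bits n)
    (hf : ∀ g : Bits n → ℝ, ∑ x₀, ∑ x₁, g (f x₀ x₁) = 2 ^ n * ∑ s, g s) :
    (e.dilute l h0 h1).learnProb f = l * e.learnProb f + (1 - l) * (1 / 2 ^ n) := by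
  refine le_antisymm ?_ ?_
  · obtain ⟨E, hE, h, -⟩ := (e.dilute l h0 h1).exists_isPOVM_learnProb_eq f
    rw [h, e.decodeProb_dilute h0 h1 f hf hE]
    gcongr
    exact e.decodeProb_le_learnProb f (IsPOVM.conj hE e.inclLeft_isometry)
  · obtain ⟨E, hE, h, -⟩ := e.exists_isPOVM_learnProb_eq f
    -- An optimal measurement of `e`, extended by guessing `0` on the flag.
    have hE' : IsPOVM fun s => e.inclLeft * E s * e.inclLeftᴴ +
        if s = 0 then e.inclRight * e.inclRightᴴ else 0 := by
      refine ⟨fun s => ((hE.posSemidef s).mul_mul_conjTranspose_same _).add ?_, ?_⟩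
      · split_ifs
        · exact Matrix.posSemidef_self_mul_conjTranspose _
        · exact Matrix.PosSemidef.zero
      · rw [Finset.sum_add_distrib, ← Matrix.sum_mul, ← Matrix.mul_sum, hE.sum_eq_one,
          Matrix.mul_one, Finset.sum_ite_eq' Finset.univ, if_pos (Finset.mem_univ _),
          e.incl_complete]
    have h5 : ∀ s, e.inclLeftᴴ * (e.inclLeft * E s * e.inclLeftᴴ +
        if s = 0 then e.inclRight * e.inclRightᴴ else 0) * e.inclLeft = E s := by
      intro s
      have h6 : e.inclLeftᴴ * (e.inclLeft * E s * e.inclLeftᴴ) * e.inclLeft = E s := by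
        rw [Matrix.mul_assoc, Matrix.mul_assoc, e.inclLeft_isometry, Matrix.mul_one,
          ← Matrix.mul_assoc, e.inclLeft_isometry, Matrix.one_mul]
      rw [Matrix.mul_add, Matrix.add_mul, h6]
      split_ifs
      · rw [← Matrix.mul_assoc, e.inclLeft_mul_inclRight]; simp
      · simp
    have h7 := e.decodeProb_dilute h0 h1 f hf hE'
    simp only [h5] at h7
    rw [h, ← h7]
    exact (e.dilute l h0 h1).decodeProb_le_learnProb f hE'

theorem exists_isPOVM_of_learnProb {p : ℝ}
    (h : 1 / 2 ^ n * ∑ c : Bits n, e.learnProb (mix c) = p) :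
    ∃ D : Bits n → Bits n → Matrix e.H e.H ℂ, (∀ c, IsPOVM (D c)) ∧
      1 / 2 ^ n * ∑ c : Bits n, e.decodeProb (mix c) (D c) = p := by
  choose D hD h1 _ using fun c : Bits n => e.exists_isPOVM_learnProb_eq (mix c)
  refine ⟨D, hD, ?_⟩
  rw [← h]
  simp only [h1]

theorem exists_learnProb_of_isPOVM {p : ℝ} (hp : 1 / 2 ^ n ≤ p) (he : e.HidesXor)
    {D : Bits n → Bits n → Matrix e.H e.H ℂ} (hD : ∀ c, IsPOVM (D c))
    (h : 1 / 2 ^ n * ∑ c : Bits n, e.decodeProb (mix c) (D c) = p) :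
    ∃ e : Encoding n, e.HidesXor ∧ 1 / 2 ^ n * ∑ c : Bits n, e.learnProb (mix c) = p := by
  set q := 1 / 2 ^ n * ∑ c : Bits n, e.learnProb (mix c) with hq
  have hpq : p ≤ q := by
    rw [← h, hq]
    gcongr with c
    exact e.decodeProb_le_learnProb _ (hD c)
  -- The case `p = q` would need `l = 1`, which `dilute` excludes; there `e` itself will do.
  rcases hpq.eq_or_lt with h1 | h1
  · exact ⟨e, he, by rw [← hq, h1]⟩
  set u : ℝ := 1 / 2 ^ n with hu
  have hqu : 0 < q - u := by linarith
  -- The solution of `l * q + (1 - l) * u = p`; `l ≥ 0` is where `1 / 2 ^ n ≤ p` enters.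
  set l := (p - u) / (q - u) with hl
  have l0 : 0 ≤ l := div_nonneg (by linarith) hqu.le
  have l1 : l < 1 := by rw [hl, div_lt_one hqu]; linarith
  have hlq : l * (q - u) = p - u := div_mul_cancel₀ _ hqu.ne'
  refine ⟨e.dilute l l0 l1, ?_, ?_⟩
  · rw [HidesXor, e.learnProb_dilute l0 l1 _ fun g => by simp [Bits.sum_xor g], he]
    ring
  · simp only [fun c : Bits n => e.learnProb_dilute l0 l1 (mix c)
      fun g => by simp [Bits.sum_mix c g]]
    have hu' : u * 2 ^ n = 1 := by rw [hu, one_div_mul_cancel (by positivity)]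
    rw [← hu, Finset.sum_add_distrib, Bits.sum_const, ← Finset.mul_sum]
    linear_combination (1 - l) * u * hu' - l * hq + hlq

end Encoding

/-! ### Bipartite pure states as coefficient matrices -/

section Bipartite

variable {X H : Type} [Fintype X] [DecidableEq X] [Fintype H] [DecidableEq H]

/-- Local measurements of the bipartite pure state with coefficient matrix `C`. -/
theorem trace_kronecker_mul_vecMulVec (C : Matrix X H ℂ) (E : Matrix X X ℂ) (F : Matrix H H ℂ) :
    ((E ⊗ₖ F) * Matrix.vecMulVec (fun p : X × H => C p.1 p.2)
      (star fun p : X × H => C p.1 p.2)).trace =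
      (E * C * Fᵀ * Cᴴ).trace := by
  simp only [Matrix.trace, Matrix.diag, Matrix.mul_apply, Matrix.kroneckerMap_apply,
    Fintype.sum_prod_type, Matrix.vecMulVec_apply, Pi.star_apply, Matrix.conjTranspose_apply,
    Matrix.transpose_apply, Finset.sum_mul]
  refine Finset.sum_congr rfl fun i _ => Finset.sum_congr rfl fun j _ => ?_
  rw [Finset.sum_comm]
  refine Finset.sum_congr rfl fun k _ => Finset.sum_congr rfl fun l _ => ?_
  ring

theorem dotProduct_kronecker_mulVec (C : Matrix X H ℂ) (E : Matrix X X ℂ) (F : Matrix H H ℂ) :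
    (star fun p : X × H => C p.1 p.2) ⬝ᵥ ((E ⊗ₖ F) *ᵥ fun p : X × H => C p.1 p.2) =
      (E * C * Fᵀ * Cᴴ).trace := by
  rw [← trace_kronecker_mul_vecMulVec, Matrix.mul_vecMulVec, Matrix.trace_vecMulVec,
    dotProduct_comm]

/-- Identifies `(Cᴴ * E * C)ᵀ` as the subnormalized state of the second system given the effect `E`
on the first. The transposes stem from writing the vector as a matrix. -/
theorem trace_mul_steered (C : Matrix X H ℂ) (E : Matrix X X ℂ) (F : Matrix H H ℂ) :
    (E * C * Fᵀ * Cᴴ).trace = (F * (Cᴴ * E * C)ᵀ).trace := by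
  rw [← Matrix.trace_transpose (F * _), Matrix.transpose_mul, Matrix.transpose_transpose,
    Matrix.trace_mul_comm, ← Matrix.mul_assoc, ← Matrix.mul_assoc, Matrix.mul_assoc (_ * _) C,
    Matrix.mul_assoc Cᴴ]

/-- The density matrix proportional to the positive matrix `τ`, or else `ρ`. -/
noncomputable def normalizeState (ρ τ : Matrix H H ℂ) : Matrix H H ℂ :=
  if τ.trace = 0 then ρ else τ.trace⁻¹ • τ

theorem Matrix.PosSemidef.ofReal_re_trace {τ : Matrix H H ℂ} (hτ : τ.PosSemidef) :
    ((τ.trace.re : ℝ) : ℂ) = τ.trace :=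
  (Complex.eq_re_of_ofReal_le hτ.trace_nonneg).symm

theorem isDensity_normalizeState {ρ τ : Matrix H H ℂ} (hρ : IsDensity ρ) (hτ : τ.PosSemidef) :
    IsDensity (normalizeState ρ τ) := by
  unfold normalizeState
  split_ifs with h
  · exact hρ
  · refine ⟨hτ.smul (inv_nonneg.2 hτ.trace_nonneg), ?_⟩
    rw [Matrix.trace_smul, smul_eq_mul, inv_mul_cancel₀ h]

/-- A positive matrix of trace zero vanishes, so the default `ρ` always carries weight zero. -/
theorem trace_mul_normalizeState {τ : Matrix H H ℂ} (ρ : Matrix H H ℂ) (hτ : τ.PosSemidef)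
    (F : Matrix H H ℂ) :
    τ.trace.re * ((F * normalizeState ρ τ).trace).re = ((F * τ).trace).re := by
  rw [← Complex.re_ofReal_mul, hτ.ofReal_re_trace]
  unfold normalizeState
  split_ifs with h
  · rw [h, hτ.trace_eq_zero_iff.1 h]; simp
  · rw [Matrix.mul_smul, Matrix.trace_smul, smul_eq_mul, mul_inv_cancel_left₀ h]

end Bipartite

/-! ### From CHSH strategies to encodings -/

namespace CHSHStrategy

variable {n : ℕ} (S : CHSHStrategy n)

/-- The coefficient matrix of the shared state. -/
def coeff : Matrix S.A S.B ℂ := fun i j => S.ψ (i, j)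

theorem answerProb_eq (x y a b : Bits n) :
    S.answerProb x y a b =
      ((S.bob y b * (S.coeffᴴ * S.alice x a * S.coeff)ᵀ).trace).re := by
  rw [answerProb, ← trace_mul_steered, ← dotProduct_kronecker_mulVec]
  rfl

theorem winProb_eq : S.winProb = ∑ x, ∑ y, 1 / 2 ^ n * (1 / 2 ^ n) *
    ∑ a, S.answerProb x y a (mix y a (a + x)) := by
  unfold winProb
  simp only [eq_mix_iff]
  simp

/-- The (subnormalized) state of Bob given Alice's question and answer. -/
def steered (x a : Bits n) : Matrix S.B S.B ℂ := (S.coeffᴴ * S.alice x a * S.coeff)ᵀ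

theorem posSemidef_steered (x a : Bits n) : (S.steered x a).PosSemidef :=
  (((S.alice_isPOVM x).posSemidef a).conjTranspose_mul_mul_same _).transpose

/-- No-signalling: the right-hand side does not depend on `x`. This is why `toEncoding` hides the
XOR. -/
theorem sum_steered (x : Bits n) : ∑ a, S.steered x a = (S.coeffᴴ * S.coeff)ᵀ := by
  simp only [steered]
  rw [← Matrix.transpose_sum, ← Matrix.sum_mul, ← Matrix.mul_sum, (S.alice_isPOVM x).sum_eq_one,
    Matrix.mul_one]

theorem isDensity_reduced : IsDensity (S.coeffᴴ * S.coeff)ᵀ := by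
  refine ⟨(Matrix.posSemidef_conjTranspose_mul_self _).transpose, ?_⟩
  have h := S.norm_ψ
  have h2 := dotProduct_kronecker_mulVec S.coeff 1 1
  rw [Matrix.one_kronecker_one, Matrix.one_mulVec, Matrix.transpose_one, Matrix.one_mul,
    Matrix.mul_one] at h2
  rw [Matrix.trace_transpose, Matrix.trace_mul_comm, ← h2]
  exact h

theorem sum_trace_steered (x : Bits n) : ∑ a, ((S.steered x a).trace).re = 1 := by
  rw [← Complex.re_sum, ← Matrix.trace_sum, S.sum_steered, S.isDensity_reduced.trace_eq_one,
    Complex.one_re]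

/-- The encoding by the state of Bob for a uniformly random question to Alice: `x₀` is Alice's
answer and the XOR is her question. -/
noncomputable def toEncoding : Encoding n where
  H := S.B
  prior x₀ x₁ := 1 / 2 ^ n * ((S.steered (x₀ + x₁) x₀).trace).re
  prior_nonneg x₀ x₁ := mul_nonneg (by positivity)
    (Complex.nonneg_iff.1 (S.posSemidef_steered _ _).trace_nonneg).1
  prior_sum := by
    rw [Bits.sum_pair_eq]
    simp only [Bits.add_add_cancel_left, ← Finset.mul_sum, S.sum_trace_steered, Bits.sum_const]
    rw [mul_one, one_div_mul_cancel (by positivity)]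
  state x₀ x₁ := normalizeState (S.coeffᴴ * S.coeff)ᵀ (S.steered (x₀ + x₁) x₀)
  isDensity x₀ x₁ := isDensity_normalizeState S.isDensity_reduced (S.posSemidef_steered _ _)

theorem decodeProb_toEncoding (f : Bits n → Bits n → Bits n)
    (E : Bits n → Matrix S.B S.B ℂ) :
    S.toEncoding.decodeProb f E =
      ∑ x, ∑ a, 1 / 2 ^ n * ((E (f a (a + x)) * S.steered x a).trace).re := by
  unfold Encoding.decodeProb
  rw [Bits.sum_pair_eq]
  refine Finset.sum_congr rfl fun x _ => Finset.sum_congr rfl fun a _ => ?_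
  rw [← trace_mul_normalizeState (S.coeffᴴ * S.coeff)ᵀ (S.posSemidef_steered x a), ← mul_assoc]
  conv_rhs => rw [← Bits.add_add_cancel_left a x]
  rw [Bits.add_add_cancel_left a (a + x)]
  rfl

theorem toEncoding_hidesXor : S.toEncoding.HidesXor := by
  refine Encoding.hidesXor_of_forall fun (E : Bits n → Matrix S.B S.B ℂ) hE => ?_
  refine (S.decodeProb_toEncoding _ E).trans ?_
  simp only [Bits.add_add_cancel_left, ← Finset.mul_sum]
  have h : ∀ x, ∑ a, ((E x * S.steered x a).trace).re =
      ((E x * (S.coeffᴴ * S.coeff)ᵀ).trace).re := fun x => by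
    rw [← Complex.re_sum, ← Matrix.trace_sum, ← Matrix.mul_sum, S.sum_steered]
  have h1 : ∑ x, E x = 1 := hE.sum_eq_one
  have h2 : ∑ x, ((E x * (S.coeffᴴ * S.coeff)ᵀ).trace).re = 1 := by
    rw [← Complex.re_sum, ← Matrix.trace_sum, ← Matrix.sum_mul, h1, Matrix.one_mul,
      S.isDensity_reduced.trace_eq_one, Complex.one_re]
  rw [Finset.sum_congr rfl fun x _ => h x, h2, mul_one]

theorem sum_decodeProb_toEncoding :
    1 / 2 ^ n * ∑ c : Bits n, S.toEncoding.decodeProb (mix c) (S.bob c) = S.winProb := by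
  rw [S.winProb_eq, Finset.sum_comm, Finset.mul_sum]
  refine Finset.sum_congr rfl fun c _ => ?_
  rw [S.decodeProb_toEncoding]
  simp only [← Finset.mul_sum, answerProb_eq, steered]
  ring

end CHSHStrategy

/-! ### From encodings to CHSH strategies -/

namespace Encoding

variable {n : ℕ} {e : Encoding n}

theorem HidesXor.exists_chshStrategy (h : e.HidesXor) {D : Bits n → Bits n → Matrix e.H e.H ℂ}
    (hD : ∀ c, IsPOVM (D c)) :
    ∃ S : CHSHStrategy n,
      S.winProb = 1 / 2 ^ n * ∑ c : Bits n, e.decodeProb (mix c) (D c) := by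
  have hpow : (0 : ℂ) ≤ 2 ^ n := by
    have : (0 : ℝ) ≤ 2 ^ n := by positivity
    exact_mod_cast Complex.zero_le_real.2 this
  -- The factor `2 ^ n` normalizes: each XOR has probability `1 / 2 ^ n`. Any XOR could replace `0`,
  -- since all conditional states agree.
  obtain ⟨C, hC⟩ := ((e.posSemidef_xorState 0).smul hpow).exists_eq_mul_conjTranspose
  have hst : ∀ x : Bits n, ∃ M : Bits n → Matrix e.H e.H ℂ, IsPOVM M ∧ ∀ a,
      C * M a * Cᴴ = (2 ^ n : ℂ) • ((e.prior a (a + x) : ℂ) • e.state a (a + x)) := by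
    intro x
    refine exists_isPOVM_steering C _ (fun a => (e.posSemidef_smul_state _ _).smul hpow) ?_
    rw [← hC, ← Finset.smul_sum, h.xorState_eq 0 x]
    rfl
  choose M hM hMC using hst
  have hCT : Cᵀᴴ = Cᴴᵀ := rfl
  -- With coefficient matrix `Cᵀ` and effects `(M x a)ᵀ`, Bob's steered state is exactly `C * M x a
  -- * Cᴴ`.
  let S : CHSHStrategy n :=
    { A := e.H
      B := e.H
      ψ := fun p => Cᵀ p.1 p.2
      norm_ψ := by
        have h2 := dotProduct_kronecker_mulVec Cᵀ 1 1
        rw [Matrix.one_kronecker_one, Matrix.one_mulVec, Matrix.transpose_one, Matrix.one_mul,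
          Matrix.mul_one] at h2
        rw [h2, hCT, ← Matrix.transpose_mul,
          Matrix.trace_transpose, Matrix.trace_mul_comm, ← hC, Matrix.trace_smul,
          h.trace_xorState, smul_eq_mul, mul_one_div_cancel (by simp)]
      alice := fun x a => (M x a)ᵀ
      alice_isPOVM := fun x => ⟨fun a => ((hM x).posSemidef a).transpose, by
        rw [← Matrix.transpose_sum, (hM x).sum_eq_one, Matrix.transpose_one]⟩
      bob := D
      bob_isPOVM := hD }
  refine ⟨S, ?_⟩
  have hans : ∀ x y a b, S.answerProb x y a b =
      2 ^ n * (e.prior a (a + x) * ((D y b * e.state a (a + x)).trace).re) := by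
    intro x y a b
    rw [S.answerProb_eq]
    have h3 : (S.coeffᴴ * S.alice x a * S.coeff)ᵀ = C * M x a * Cᴴ := by
      change (Cᵀᴴ * (M x a)ᵀ * Cᵀ)ᵀ = _
      rw [Matrix.transpose_mul, Matrix.transpose_mul, Matrix.transpose_transpose,
        Matrix.transpose_transpose, hCT,
        Matrix.transpose_transpose, Matrix.mul_assoc]
    refine (congrArg (fun N => ((D y b * N).trace).re) (h3.trans (hMC x a))).trans ?_
    have h4 : (2 ^ n : ℂ) = ((2 ^ n : ℝ) : ℂ) := by push_cast; rfl
    rw [Matrix.mul_smul, Matrix.mul_smul, Matrix.trace_smul, Matrix.trace_smul, smul_eq_mul,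
      smul_eq_mul, h4, Complex.re_ofReal_mul, Complex.re_ofReal_mul]
  rw [S.winProb_eq, Finset.sum_comm, Finset.mul_sum]
  refine Finset.sum_congr rfl fun c _ => ?_
  simp only [hans, decodeProb]
  rw [Bits.sum_pair_eq, Finset.mul_sum]
  refine Finset.sum_congr rfl fun x _ => ?_
  rw [← Finset.mul_sum]
  have : (2 : ℝ) ^ n ≠ 0 := by positivity
  field_simp

end Encoding

/-! ### Tensor products and outcome probabilities of protocols -/

section Kronecker

variable {ι A H : Type} [Fintype A] [DecidableEq A] [Fintype H] [DecidableEq H]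

theorem Matrix.sum_kronecker (s : Finset ι) (E : ι → Matrix A A ℂ) (F : Matrix H H ℂ) :
    (∑ i ∈ s, E i) ⊗ₖ F = ∑ i ∈ s, E i ⊗ₖ F := by
  ext; simp [Matrix.sum_apply, Finset.sum_mul]

theorem Matrix.kronecker_sum (s : Finset ι) (E : Matrix A A ℂ) (F : ι → Matrix H H ℂ) :
    E ⊗ₖ (∑ i ∈ s, F i) = ∑ i ∈ s, E ⊗ₖ F i := by
  ext; simp [Matrix.sum_apply, Finset.mul_sum]

theorem Matrix.sum_single_self : ∑ a : A, Matrix.single a a (1 : ℂ) = 1 := by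
  ext i j
  simp [Matrix.sum_apply, Matrix.single_apply, Matrix.one_apply, ite_and]

theorem Matrix.posSemidef_single_self (a : A) : (Matrix.single a a (1 : ℂ)).PosSemidef := by
  have : Matrix.single a a (1 : ℂ) = Matrix.single a a (1 : ℂ) * (Matrix.single a a (1 : ℂ))ᴴ := by
    simp
  rw [this]
  exact Matrix.posSemidef_self_mul_conjTranspose _

end Kronecker

section Interaction

variable {M : Type} [Fintype M] [DecidableEq M] (k : ℕ) (S : AliceStrategy M) (T : BobStrategy M)
  {ι : Type}

theorem outcomeProb_sum_left (s : Finset ι) (E : ι → Matrix S.A S.A ℂ)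
    (F : Matrix (M × T.B) (M × T.B) ℂ) :
    outcomeProb k S T (∑ i ∈ s, E i) F = ∑ i ∈ s, outcomeProb k S T (E i) F := by
  simp only [outcomeProb, Matrix.sum_kronecker, Matrix.sum_mul, Matrix.trace_sum, Complex.re_sum]

theorem outcomeProb_sum_right (s : Finset ι) (E : Matrix S.A S.A ℂ)
    (F : ι → Matrix (M × T.B) (M × T.B) ℂ) :
    outcomeProb k S T E (∑ i ∈ s, F i) = ∑ i ∈ s, outcomeProb k S T E (F i) := by
  simp only [outcomeProb, Matrix.kronecker_sum, Matrix.sum_mul, Matrix.trace_sum, Complex.re_sum]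

theorem outcomeProb_smul_right (c : ℝ) (E : Matrix S.A S.A ℂ) (F : Matrix (M × T.B) (M × T.B) ℂ) :
    outcomeProb k S T E ((c : ℂ) • F) = c * outcomeProb k S T E F := by
  simp only [outcomeProb, Matrix.kronecker_smul, Matrix.smul_mul, Matrix.trace_smul, smul_eq_mul,
    Complex.re_ofReal_mul]

theorem outcomeProb_zero_left (F : Matrix (M × T.B) (M × T.B) ℂ) :
    outcomeProb k S T 0 F = 0 := by
  simp [outcomeProb]

theorem outcomeProb_zero_right (E : Matrix S.A S.A ℂ) :
    outcomeProb k S T E 0 = 0 := by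
  simp [outcomeProb]

/-- The channel that does nothing. -/
def Channel.id (H : Type) [Fintype H] [DecidableEq H] : Channel H where
  rank := 1
  kraus _ := 1
  complete := by simp

/-- The action of a channel on a state. -/
noncomputable def Channel.apply {H : Type} [Fintype H] [DecidableEq H] (Φ : Channel H)
    (ρ : Matrix H H ℂ) : Matrix H H ℂ :=
  ∑ j, Φ.kraus j * ρ * (Φ.kraus j)ᴴ

theorem Channel.apply_id {H : Type} [Fintype H] [DecidableEq H] (ρ : Matrix H H ℂ) :
    (Channel.id H).apply ρ = ρ := by
  change ∑ _j : Fin 1, (1 : Matrix H H ℂ) * ρ * (1 : Matrix H H ℂ)ᴴ = ρ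
  simp

theorem Channel.apply_sum {H : Type} [Fintype H] [DecidableEq H] (Φ : Channel H)
    (s : Finset ι) (ρ : ι → Matrix H H ℂ) : Φ.apply (∑ i ∈ s, ρ i) = ∑ i ∈ s, Φ.apply (ρ i) := by
  simp only [Channel.apply, Matrix.mul_sum, Matrix.sum_mul]
  rw [Finset.sum_comm]

/-- Alice sends Bob the state `μ a` with the probability given by its trace, and remembers `a`. -/
noncomputable def AliceStrategy.ofEnsemble {A : Type} [Fintype A] [DecidableEq A]
    (μ : A → Matrix M M ℂ) (hμ : ∀ a, (μ a).PosSemidef) (h : ∑ a, (μ a).trace = 1) :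
    AliceStrategy M where
  A := A
  start := ∑ a, Matrix.single a a (1 : ℂ) ⊗ₖ μ a
  isDensity := ⟨Matrix.posSemidef_sum _ fun a _ => (Matrix.posSemidef_single_self a).kronecker
    (hμ a), by simp [Matrix.trace_sum, Matrix.trace_kronecker, h]⟩
  op _ := Channel.id _

/-- Alice keeps a classical label and acts trivially, so Bob's channel works on each branch
separately. -/
theorem jointState_ofEnsemble {A : Type} [Fintype A] [DecidableEq A]
    (μ : A → Matrix M M ℂ) (hμ : ∀ a, (μ a).PosSemidef) (h : ∑ a, (μ a).trace = 1) :
    jointState (AliceStrategy.ofEnsemble μ hμ h) T 1 =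
      ∑ a : A, Matrix.single a a (1 : ℂ) ⊗ₖ (T.op 0).apply (μ a ⊗ₖ T.start) := by
  have h0 : jointState (AliceStrategy.ofEnsemble μ hμ h) T 0 =
      ∑ a : A, Matrix.single a a (1 : ℂ) ⊗ₖ (μ a ⊗ₖ T.start) := by
    change ((∑ a : A, Matrix.single a a (1 : ℂ) ⊗ₖ μ a) ⊗ₖ T.start).reindex
      (Equiv.prodAssoc A M T.B) (Equiv.prodAssoc A M T.B) = _
    ext ⟨a, m, b⟩ ⟨a', m', b'⟩
    simp [Matrix.sum_apply, Finset.sum_mul, mul_assoc]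
  have h1 : onAlice (B := T.B) (1 : Matrix (A × M) (A × M) ℂ) = 1 := by
    simp [onAlice]
  have h2 : ∀ J : Matrix (A × M × T.B) (A × M × T.B) ℂ,
      J = ∑ a : A, Matrix.single a a (1 : ℂ) ⊗ₖ (μ a ⊗ₖ T.start) →
      ∑ j, onBob ((T.op 0).kraus j) * (∑ _i : Fin 1, onAlice (1 : Matrix (A × M) (A × M) ℂ) *
        J * (onAlice 1)ᴴ) * (onBob ((T.op 0).kraus j))ᴴ =
      ∑ a : A, Matrix.single a a (1 : ℂ) ⊗ₖ (T.op 0).apply (μ a ⊗ₖ T.start) := by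
    rintro _ rfl
    rw [h1]
    simp only [Matrix.one_mul, Matrix.conjTranspose_one, Matrix.mul_one, Finset.univ_unique,
      Finset.sum_singleton, Channel.apply, Matrix.kronecker_sum, Matrix.mul_sum, Matrix.sum_mul]
    rw [Finset.sum_comm]
    refine Finset.sum_congr rfl fun a _ => Finset.sum_congr rfl fun j _ => ?_
    rw [onBob, Matrix.conjTranspose_kronecker, ← Matrix.mul_kronecker_mul,
      ← Matrix.mul_kronecker_mul, Matrix.one_mul, Matrix.conjTranspose_one, Matrix.mul_one]
  exact h2 _ h0

theorem outcomeProb_ofEnsemble {A : Type} [Fintype A] [DecidableEq A]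
    (μ : A → Matrix M M ℂ) (hμ : ∀ a, (μ a).PosSemidef) (h : ∑ a, (μ a).trace = 1) (a : A)
    (F : Matrix (M × T.B) (M × T.B) ℂ) :
    outcomeProb 1 (AliceStrategy.ofEnsemble μ hμ h) T
        (Matrix.single a a (1 : ℂ) : Matrix A A ℂ) F =
      ((F * (T.op 0).apply (μ a ⊗ₖ T.start)).trace).re := by
  have : outcomeProb 1 (AliceStrategy.ofEnsemble μ hμ h) T
      (Matrix.single a a (1 : ℂ) : Matrix A A ℂ) F = (((Matrix.single a a (1 : ℂ) ⊗ₖ F) *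
      ∑ a : A, Matrix.single a a (1 : ℂ) ⊗ₖ (T.op 0).apply (μ a ⊗ₖ T.start)).trace).re :=
    congrArg (fun N : Matrix (A × M × T.B) (A × M × T.B) ℂ =>
      (((Matrix.single a a (1 : ℂ) ⊗ₖ F) * N).trace).re)
      (jointState_ofEnsemble T μ hμ h)
  rw [this, Matrix.mul_sum, Matrix.trace_sum, Finset.sum_eq_single a]
  · rw [← Matrix.mul_kronecker_mul, Matrix.trace_kronecker]
    simp
  · intro b _ hb
    rw [← Matrix.mul_kronecker_mul, Matrix.single_mul_single_of_ne _ _ _ _ hb.symm]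
    simp
  · simp

end Interaction

/-! ### From encodings to non-interactive protocols -/

namespace Encoding

variable {n : ℕ} {e : Encoding n}

/-- The state that Alice sends when her strings are `z.1`, `z.2`: they are an encoded pair
shifted by a uniformly random string, which is part of the message. -/
noncomputable def message (e : Encoding n) (z : Bits n × Bits n) :
    Matrix (e.H × Bits n) (e.H × Bits n) ℂ :=
  ∑ r, ((1 / 2 ^ n : ℝ) : ℂ) • (((e.prior (z.1 + r) (z.2 + r) : ℂ) •
    e.state (z.1 + r) (z.2 + r)) ⊗ₖ Matrix.single r r (1 : ℂ))

theorem posSemidef_message (z : Bits n × Bits n) : (e.message z).PosSemidef :=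
  Matrix.posSemidef_sum _ fun r _ => ((e.posSemidef_smul_state _ _).kronecker
    (Matrix.posSemidef_single_self r)).smul (Complex.zero_le_real.2 (by positivity))

/-- The pad becomes independent of the encoding once the strings are summed out with their XOR
fixed, so a hidden XOR stays hidden when the pad is sent along. -/
theorem sum_message (s : Bits n) :
    ∑ x₀, e.message (x₀, x₀ + s) =
      ((1 / 2 ^ n : ℝ) : ℂ) • (e.xorState s ⊗ₖ (1 : Matrix (Bits n) (Bits n) ℂ)) := by
  simp only [message]
  rw [Finset.sum_comm, ← Matrix.sum_single_self, Matrix.kronecker_sum, Finset.smul_sum]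
  refine Finset.sum_congr rfl fun r _ => ?_
  rw [← Finset.smul_sum, ← Matrix.sum_kronecker, xorState,
    ← Bits.sum_add_right r fun x₀ => (e.prior x₀ (x₀ + s) : ℂ) • e.state x₀ (x₀ + s)]
  simp only [add_right_comm]

/-- The pad makes the pair uniform for a given XOR, and a hidden XOR is itself uniform. -/
theorem HidesXor.trace_message (h : e.HidesXor) (z : Bits n × Bits n) :
    (e.message z).trace = ((1 / 2 ^ n * (1 / 2 ^ n) : ℝ) : ℂ) := by
  obtain ⟨z₀, z₁⟩ := z
  simp only [message, Matrix.trace_sum, Matrix.trace_smul, Matrix.trace_kronecker,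
    (e.isDensity _ _).trace_eq_one, Matrix.trace_single_eq_same, smul_eq_mul, mul_one]
  have h1 := h.trace_xorState (z₀ + z₁)
  rw [Encoding.trace_xorState, ← Bits.sum_add_left z₀] at h1
  have h2 : ∀ r, z₀ + r + (z₀ + z₁) = z₁ + r := fun r => by
    rw [add_comm z₀ r, add_assoc, Bits.add_add_cancel_left, add_comm]
  simp only [h2] at h1
  rw [← Finset.mul_sum, h1]
  push_cast; rfl

theorem HidesXor.sum_trace_message (h : e.HidesXor) : ∑ z, (e.message z).trace = 1 := by
  simp only [h.trace_message, ← Complex.ofReal_sum, Fintype.sum_prod_type, Bits.sum_const]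
  have : (2 : ℝ) ^ n ≠ 0 := by positivity
  rw [Complex.ofReal_eq_one]
  field_simp

/-- Bob chooses his index string `b` uniformly at random, measures `D b`, and undoes the shift. -/
noncomputable def receive (D : Bits n → Bits n → Matrix e.H e.H ℂ) (b w : Bits n) :
    Matrix (e.H × Bits n) (e.H × Bits n) ℂ :=
  ((1 / 2 ^ n : ℝ) : ℂ) • ∑ r, D b (w + r) ⊗ₖ Matrix.single r r (1 : ℂ)

theorem posSemidef_receive {D : Bits n → Bits n → Matrix e.H e.H ℂ} (hD : ∀ c, IsPOVM (D c))
    (b w : Bits n) : (receive D b w).PosSemidef :=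
  (Matrix.posSemidef_sum _ fun r _ => ((hD b).posSemidef _).kronecker
    (Matrix.posSemidef_single_self r)).smul (Complex.zero_le_real.2 (by positivity))

theorem sum_receive {D : Bits n → Bits n → Matrix e.H e.H ℂ} (hD : ∀ c, IsPOVM (D c))
    (b : Bits n) : ∑ w, receive D b w = ((1 / 2 ^ n : ℝ) : ℂ) • 1 := by
  simp only [receive]
  rw [← Finset.smul_sum, Finset.sum_comm]
  simp only [← Matrix.sum_kronecker, Bits.sum_add_right _ (D b), (hD b).sum_eq_one]
  rw [← Matrix.kronecker_sum, Matrix.sum_single_self, Matrix.one_kronecker_one]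

/-- The pad register is diagonal on both sides, so only equal pads contribute. -/
theorem trace_receive_mul_message (D : Bits n → Bits n → Matrix e.H e.H ℂ) (b w : Bits n)
    (z : Bits n × Bits n) :
    ((receive D b w * e.message z).trace).re = 1 / 2 ^ n * ∑ r, 1 / 2 ^ n *
      (e.prior (z.1 + r) (z.2 + r) *
        ((D b (w + r) * e.state (z.1 + r) (z.2 + r)).trace).re) := by
  rw [receive, message, Matrix.smul_mul, Matrix.trace_smul, smul_eq_mul, Complex.re_ofReal_mul,
    Matrix.sum_mul, Matrix.trace_sum, Complex.re_sum]
  congr 1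
  refine Finset.sum_congr rfl fun r _ => ?_
  rw [Matrix.mul_sum, Matrix.trace_sum, Finset.sum_eq_single r]
  · rw [Matrix.mul_smul, Matrix.trace_smul, smul_eq_mul, Complex.re_ofReal_mul,
      ← Matrix.mul_kronecker_mul, Matrix.trace_kronecker, Matrix.mul_smul, Matrix.trace_smul]
    simp
  · intro s _ hs
    rw [Matrix.mul_smul, ← Matrix.mul_kronecker_mul,
      Matrix.single_mul_single_of_ne _ _ _ _ hs.symm]
    simp
  · simp

/-- The non-interactive protocol in which Alice sends Bob an encoding of her strings. -/
noncomputable def toProtocol (h : e.HidesXor) (D : Bits n → Bits n → Matrix e.H e.H ℂ)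
    (hD : ∀ c, IsPOVM (D c)) : Protocol n where
  M := e.H × Bits n
  rounds := 1
  alice := AliceStrategy.ofEnsemble e.message (fun z => e.posSemidef_message z) h.sum_trace_message
  bob :=
    { B := Unit
      start := 1
      isDensity := ⟨Matrix.PosSemidef.one, by simp⟩
      op := fun _ => Channel.id _ }
  aliceOut u := u.elim 0 fun z => (Matrix.single z z (1 : ℂ) : Matrix (Bits n × Bits n) _ ℂ)
  aliceOut_isPOVM := by
    refine ⟨?_, ?_⟩
    · rintro (_ | z)
      · exact Matrix.PosSemidef.zero
      · exact Matrix.posSemidef_single_self z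
    · rw [Fintype.sum_option]
      exact (zero_add _).trans Matrix.sum_single_self
  bobOut v := v.elim 0 fun v => receive D v.1 v.2 ⊗ₖ (1 : Matrix Unit Unit ℂ)
  bobOut_isPOVM := by
    refine ⟨?_, ?_⟩
    · rintro (_ | v)
      · exact Matrix.PosSemidef.zero
      · exact (posSemidef_receive hD _ _).kronecker Matrix.PosSemidef.one
    · rw [Fintype.sum_option]
      simp only [Option.elim_none, Option.elim_some, zero_add, ← Matrix.sum_kronecker,
        Fintype.sum_prod_type, sum_receive hD]
      rw [← Finset.sum_smul, ← Complex.ofReal_sum, Bits.sum_const,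
        mul_one_div_cancel (by positivity), Complex.ofReal_one, one_smul,
        Matrix.one_kronecker_one]

variable (h : e.HidesXor) (D : Bits n → Bits n → Matrix e.H e.H ℂ) (hD : ∀ c, IsPOVM (D c))

theorem outcomeProb_toProtocol (T : BobStrategy (e.H × Bits n)) (z : Bits n × Bits n)
    (F : Matrix ((e.H × Bits n) × T.B) ((e.H × Bits n) × T.B) ℂ) :
    outcomeProb 1 (toProtocol h D hD).alice T ((toProtocol h D hD).aliceOut (some z)) F =
      ((F * (T.op 0).apply (e.message z ⊗ₖ T.start)).trace).re :=
  outcomeProb_ofEnsemble T e.message (fun z => e.posSemidef_message z) h.sum_trace_message z F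

theorem sum_bobOut_toProtocol (b : Bits n) :
    ∑ w, (toProtocol h D hD).bobOut (some (b, w)) = ((1 / 2 ^ n : ℝ) : ℂ) • 1 := by
  change ∑ w, receive D b w ⊗ₖ (1 : Matrix Unit Unit ℂ) = _
  rw [← Matrix.sum_kronecker, sum_receive hD, Matrix.smul_kronecker, Matrix.one_kronecker_one]
  rfl

theorem honestProb_toProtocol (z : Bits n × Bits n) (b w : Bits n) :
    (toProtocol h D hD).honestProb (some z) (some (b, w)) =
      ((receive D b w * e.message z).trace).re := by
  refine (outcomeProb_toProtocol h D hD _ z _).trans ?_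
  change (((receive D b w ⊗ₖ (1 : Matrix Unit Unit ℂ)) *
    (Channel.id _).apply (e.message z ⊗ₖ (1 : Matrix Unit Unit ℂ))).trace).re = _
  rw [Channel.apply_id, ← Matrix.mul_kronecker_mul, Matrix.trace_kronecker]
  simp

theorem honestProb_toProtocol_none_left (v : Option (Bits n × Bits n)) :
    (toProtocol h D hD).honestProb none v = 0 :=
  outcomeProb_zero_left _ _ _ _

theorem honestProb_toProtocol_none_right (u : Option (Bits n × Bits n)) :
    (toProtocol h D hD).honestProb u none = 0 :=
  outcomeProb_zero_right _ _ _ _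

theorem sum_honestProb_toProtocol (z : Bits n × Bits n) (b : Bits n) :
    ∑ w, (toProtocol h D hD).honestProb (some z) (some (b, w)) =
      1 / 2 ^ n * (1 / 2 ^ n * (1 / 2 ^ n)) := by
  simp only [honestProb_toProtocol]
  rw [← Complex.re_sum, ← Matrix.trace_sum, ← Matrix.sum_mul, sum_receive hD, Matrix.smul_mul,
    Matrix.one_mul, Matrix.trace_smul, h.trace_message, smul_eq_mul, Complex.re_ofReal_mul,
    Complex.ofReal_re]

theorem toProtocol_isOT :
    (toProtocol h D hD).IsOT (1 / 2 ^ n * ∑ c : Bits n, e.decodeProb (mix c) (D c)) where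
  alice_no_abort := by simp only [honestProb_toProtocol_none_left, Finset.sum_const_zero]
  bob_no_abort := by simp only [honestProb_toProtocol_none_right, Finset.sum_const_zero]
  alice_uniform z₀ z₁ := by
    rw [Fintype.sum_option, honestProb_toProtocol_none_right, zero_add, Fintype.sum_prod_type]
    simp only [sum_honestProb_toProtocol, Bits.sum_const]
    rw [← mul_assoc, mul_one_div_cancel (by positivity), one_mul]
  bob_uniform b := by
    rw [Fintype.sum_option, Fintype.sum_prod_type]
    simp only [sum_honestProb_toProtocol, honestProb_toProtocol_none_left, Finset.sum_const_zero,
      zero_add, Bits.sum_const]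
    have : (2 : ℝ) ^ n ≠ 0 := by positivity
    field_simp
  correct := by
    simp only [honestProb_toProtocol, trace_receive_mul_message, ← mix_add_left]
    have h1 : ∀ b r : Bits n, ∑ z₀ : Bits n, ∑ z₁ : Bits n, (1 / 2 ^ n * (1 / 2 ^ n *
        (e.prior (z₀ + r) (z₁ + r) * ((D b (mix b (z₀ + r) (z₁ + r)) *
          e.state (z₀ + r) (z₁ + r)).trace).re)) : ℝ) =
        1 / 2 ^ n * (1 / 2 ^ n * e.decodeProb (mix b) (D b)) := by
      intro b r
      simp only [← Finset.mul_sum]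
      congr 2
      unfold decodeProb
      rw [← Bits.sum_add_right r fun x₀ => ∑ x₁, e.prior x₀ x₁ * _]
      refine Finset.sum_congr rfl fun x₀ _ => ?_
      rw [← Bits.sum_add_right r fun x₁ => e.prior (x₀ + r) x₁ * _]
    calc _ = ∑ b : Bits n, ∑ r : Bits n, ∑ z₀ : Bits n, ∑ z₁ : Bits n, (1 / 2 ^ n * (1 / 2 ^ n *
        (e.prior (z₀ + r) (z₁ + r) * ((D b (mix b (z₀ + r) (z₁ + r)) *
          e.state (z₀ + r) (z₁ + r)).trace).re)) : ℝ) := by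
          simp only [Finset.mul_sum]
          rw [Finset.sum_congr rfl fun z₀ _ => Finset.sum_comm, Finset.sum_comm]
          refine Finset.sum_congr rfl fun b _ => ?_
          rw [Finset.sum_congr rfl fun z₀ _ => Finset.sum_comm, Finset.sum_comm]
      _ = _ := by
          simp only [h1, Bits.sum_const, Finset.mul_sum]
          refine Finset.sum_congr rfl fun b _ => ?_
          have : (2 : ℝ) ^ n ≠ 0 := by positivity
          field_simp

/-- Summed over `w`, the effect of index `b` is a multiple of the identity: `b` is independent of
anything Alice sends. -/
theorem toProtocol_secureAgainstAlice : (toProtocol h D hD).SecureAgainstAlice := by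
  intro S G hG
  simp only [← outcomeProb_sum_right, sum_bobOut_toProtocol, outcomeProb_smul_right]
  rw [← Finset.mul_sum, ← outcomeProb_sum_left, hG.sum_eq_one, Bits.sum_const]
  have : (2 : ℝ) ^ n ≠ 0 := by positivity
  field_simp

theorem toProtocol_secureAgainstBob : (toProtocol h D hD).SecureAgainstBob := by
  intro (T : BobStrategy (e.H × Bits n))
    (G : Bits n → Matrix ((e.H × Bits n) × T.B) ((e.H × Bits n) × T.B) ℂ) (hG : IsPOVM G)
  -- The cheater's subnormalized final state given the XOR; it is the same for every XOR, so `0` may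
  -- stand for all.
  set Θ := (T.op 0).apply ((((1 / 2 ^ n : ℝ) : ℂ) •
    (e.xorState 0 ⊗ₖ (1 : Matrix (Bits n) (Bits n) ℂ))) ⊗ₖ T.start) with hΘ
  have key : ∀ F : Bits n → Matrix ((e.H × Bits n) × T.B) ((e.H × Bits n) × T.B) ℂ,
      ∑ z₀, ∑ z₁, outcomeProb 1 (toProtocol h D hD).alice T
        ((toProtocol h D hD).aliceOut (some (z₀, z₁))) (F (z₀ + z₁)) =
      (((∑ s, F s) * Θ).trace).re := by
    intro F
    rw [Bits.sum_pair_eq, Matrix.sum_mul, Matrix.trace_sum, Complex.re_sum]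
    refine Finset.sum_congr rfl fun s _ => ?_
    simp only [Bits.add_add_cancel_left]
    rw [Finset.sum_congr rfl fun z₀ _ => outcomeProb_toProtocol h D hD T (z₀, z₀ + s) (F s),
      ← Complex.re_sum, ← Matrix.trace_sum, ← Matrix.mul_sum, ← Channel.apply_sum,
      ← Matrix.sum_kronecker, sum_message, h.xorState_eq s 0]
  have h1 := key G
  have h2 := key fun _ => 1
  refine h1.trans ?_
  rw [hG.sum_eq_one]
  refine Eq.trans ?_ (congrArg (1 / 2 ^ n * ·) h2.symm)
  rw [Matrix.sum_mul, Matrix.trace_sum, Complex.re_sum, Bits.sum_const, Matrix.one_mul]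
  have : (2 : ℝ) ^ n ≠ 0 := by positivity
  field_simp

end Encoding

/-! ### Recording which Kraus operator was applied -/

section Record

variable {N ι E₀ J : Type} [Fintype N] [DecidableEq N] [Fintype ι] [DecidableEq ι]
  [Fintype E₀] [DecidableEq E₀] [Fintype J] [DecidableEq J]

/-- The operator `|j⟩⟨v|` on the cell `c` of an array of cells (next to a further register). -/
def cellShift (c : ι) (j v : J) : Matrix (E₀ × (ι → J)) (E₀ × (ι → J)) ℂ :=
  fun e e' => if e'.2 c = v ∧ e = (e'.1, Function.update e'.2 c j) then 1 else 0

/-- Summing over the discarded content `v` gives orthogonality in the written symbol, which kills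
the cross terms between different Kraus operators. -/
theorem sum_cellShift (c : ι) (i j : J) :
    ∑ v, (cellShift c i v : Matrix (E₀ × (ι → J)) (E₀ × (ι → J)) ℂ)ᴴ * cellShift c j v =
      if i = j then 1 else 0 := by
  ext e e'
  simp only [Matrix.sum_apply, Matrix.mul_apply, Matrix.conjTranspose_apply, cellShift]
  have h1 : ∀ v, ∑ x : E₀ × (ι → J),
      star (if e.2 c = v ∧ x = (e.1, Function.update e.2 c i) then 1 else 0 : ℂ) *
        (if e'.2 c = v ∧ x = (e'.1, Function.update e'.2 c j) then 1 else 0) =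
      if e.2 c = v then (if e'.2 c = e.2 c ∧
        (e.1, Function.update e.2 c i) = (e'.1, Function.update e'.2 c j) then 1 else 0) else 0 := by
    intro v
    by_cases hv : e.2 c = v
    · subst hv
      simp only [true_and, if_true]
      rw [Finset.sum_eq_single (e.1, Function.update e.2 c i)]
      · simp
      · intro x _ hx; simp [hx]
      · simp
    · simp [hv]
  simp only [h1, Finset.sum_ite_eq, Finset.mem_univ, if_true]
  by_cases hij : i = j
  · subst hij
    rw [if_pos rfl, Matrix.one_apply]
    refine if_congr ⟨?_, ?_⟩ rfl rfl
    · rintro ⟨h2, h3⟩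
      rw [Prod.mk.injEq] at h3
      refine Prod.ext h3.1 (funext fun s => ?_)
      by_cases hs : s = c
      · rw [hs, h2]
      · simpa [hs] using congrFun h3.2 s
    · rintro rfl; exact ⟨rfl, rfl⟩
  · rw [if_neg hij, if_neg]
    · rfl
    · rintro ⟨-, h3⟩
      rw [Prod.mk.injEq] at h3
      exact hij (by simpa using congrFun h3.2 c)

/-- Perform `κ` and record in the cell `c`, after discarding its content `v`, which of the Kraus
operators was applied. -/
def recordKraus (κ : J → Matrix N N ℂ) (c : ι) (v : J) :
    Matrix (N × E₀ × (ι → J)) (N × E₀ × (ι → J)) ℂ :=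
  ∑ j, κ j ⊗ₖ cellShift c j v

/-- The recording is invisible to whoever has no access to the record. -/
theorem sum_recordKraus_conj (κ : J → Matrix N N ℂ) (c : ι) (Z : Matrix N N ℂ) :
    ∑ v, (recordKraus (E₀ := E₀) κ c v)ᴴ * (Z ⊗ₖ 1) * recordKraus κ c v =
      (∑ j, (κ j)ᴴ * Z * κ j) ⊗ₖ 1 := by
  have h1 : ∀ v, (recordKraus (E₀ := E₀) κ c v)ᴴ * (Z ⊗ₖ 1) * recordKraus κ c v =
      ∑ i, ∑ j, ((κ i)ᴴ * Z * κ j) ⊗ₖ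
        ((cellShift c i v : Matrix (E₀ × (ι → J)) _ ℂ)ᴴ * cellShift c j v) := by
    intro v
    simp only [recordKraus, Matrix.conjTranspose_sum, Matrix.conjTranspose_kronecker,
      Matrix.sum_mul, Matrix.mul_sum, ← Matrix.mul_kronecker_mul, Matrix.mul_one]
    rw [Finset.sum_comm]
  simp only [h1]
  rw [Finset.sum_comm, Matrix.sum_kronecker]
  refine Finset.sum_congr rfl fun i _ => ?_
  rw [Finset.sum_comm]
  simp only [← Matrix.kronecker_sum, sum_cellShift]
  rw [Finset.sum_eq_single i]
  · rw [if_pos rfl]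
  · intro j _ hj; rw [if_neg hj.symm, Matrix.kronecker_zero]
  · simp

theorem cellShift_eq_zero {c : ι} {j v : J} {e e' : E₀ × (ι → J)} (h : e'.2 c ≠ v) :
    cellShift c j v e e' = 0 :=
  if_neg fun h' => h h'.1

theorem cellShift_eq_zero_of_ne {c s : ι} {j v : J} {e e' : E₀ × (ι → J)} (hs : s ≠ c)
    (h : e.2 s ≠ e'.2 s) : cellShift c j v e e' = 0 :=
  if_neg fun h' => h (by rw [h'.2]; simp [hs])

/-- On a cell known to contain `v₀`, only one recording operator acts, so a pure state stays pure.
-/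
theorem recordKraus_mulVec_eq_zero (κ : J → Matrix N N ℂ) {c : ι} {v₀ v : J} (hv : v ≠ v₀)
    {x : N × E₀ × (ι → J) → ℂ} (hx : ∀ n e, e.2 c ≠ v₀ → x (n, e) = 0) :
    recordKraus κ c v *ᵥ x = 0 := by
  funext y
  simp only [Matrix.mulVec, dotProduct, Pi.zero_apply]
  refine Finset.sum_eq_zero fun p _ => ?_
  by_cases h : p.2.2 c = v
  · rw [hx p.1 p.2 (by rw [h]; exact hv), mul_zero]
  · simp [recordKraus, Matrix.sum_apply, cellShift_eq_zero h]

theorem recordKraus_mulVec_blank (κ : J → Matrix N N ℂ) {c s : ι} (hs : s ≠ c) (v₀ v : J)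
    {x : N × E₀ × (ι → J) → ℂ} (hx : ∀ n e, e.2 s ≠ v₀ → x (n, e) = 0) :
    ∀ n e, e.2 s ≠ v₀ → (recordKraus κ c v *ᵥ x) (n, e) = 0 := by
  intro n e he
  simp only [Matrix.mulVec, dotProduct]
  refine Finset.sum_eq_zero fun p _ => ?_
  by_cases h : e.2 s = p.2.2 s
  · rw [hx p.1 p.2 (by rw [← h]; exact he), mul_zero]
  · simp [recordKraus, Matrix.sum_apply, cellShift_eq_zero_of_ne hs h]

theorem kronecker_one_mulVec_eq_zero {E : Type} [Fintype E] [DecidableEq E] (K : Matrix N N ℂ)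
    {x : N × E → ℂ} {e : E} (hx : ∀ n, x (n, e) = 0) (n : N) :
    ((K ⊗ₖ (1 : Matrix E E ℂ)) *ᵥ x) (n, e) = 0 := by
  simp only [Matrix.mulVec, dotProduct, Fintype.sum_prod_type, Matrix.kroneckerMap_apply]
  refine Finset.sum_eq_zero fun n' _ => Finset.sum_eq_zero fun e' _ => ?_
  by_cases h : e = e'
  · subst h; rw [hx, mul_zero]
  · rw [Matrix.one_apply_ne h]; simp

theorem Matrix.sum_mul_vecMulVec_mul_conjTranspose {K : Type} [Fintype K] [DecidableEq K]
    {L : K → Matrix N N ℂ} {x : N → ℂ} {k₀ : K} (h : ∀ k, k ≠ k₀ → L k *ᵥ x = 0) :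
    ∑ k, L k * Matrix.vecMulVec x (star x) * (L k)ᴴ =
      Matrix.vecMulVec (L k₀ *ᵥ x) (star (L k₀ *ᵥ x)) := by
  have h1 : ∀ k, L k * Matrix.vecMulVec x (star x) * (L k)ᴴ =
      Matrix.vecMulVec (L k *ᵥ x) (star (L k *ᵥ x)) := fun k => by
    rw [Matrix.mul_vecMulVec, Matrix.vecMulVec_mul, Matrix.star_mulVec]
  simp only [h1]
  refine Finset.sum_eq_single k₀ (fun k _ hk => ?_) (by simp)
  rw [h k hk, Matrix.zero_vecMulVec]

/-- The partial trace, in the Heisenberg picture. -/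
theorem trace_submatrix_kronecker_one_mul {E P : Type} [Fintype E] [DecidableEq E] [Fintype P]
    (σ : P ≃ N × E) (Z : Matrix N N ℂ) (Y : Matrix P P ℂ) :
    ((Z ⊗ₖ (1 : Matrix E E ℂ)).submatrix σ σ * Y).trace =
      (Z * Matrix.of fun n n' => ∑ e, Y (σ.symm (n, e)) (σ.symm (n', e))).trace := by
  have h1 : ((Z ⊗ₖ (1 : Matrix E E ℂ)).submatrix σ σ * Y).trace =
      ((Z ⊗ₖ (1 : Matrix E E ℂ)) * Y.submatrix σ.symm σ.symm).trace := by
    have : Y = (Y.submatrix σ.symm σ.symm).submatrix σ σ := by simp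
    conv_lhs => rw [this]
    rw [Matrix.submatrix_mul_equiv]
    exact σ.sum_comp fun p =>
      ((Z ⊗ₖ (1 : Matrix E E ℂ)) * Y.submatrix σ.symm σ.symm) p p
  rw [h1]
  simp only [Matrix.trace, Matrix.diag, Matrix.mul_apply, Fintype.sum_prod_type,
    Matrix.kroneckerMap_apply, Matrix.submatrix_apply, Matrix.of_apply, Finset.mul_sum,
    Matrix.one_apply, mul_ite, mul_one, mul_zero, ite_mul, zero_mul, Finset.sum_ite_eq,
    Finset.mem_univ, if_true]
  refine Finset.sum_congr rfl fun n _ => ?_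
  rw [Finset.sum_comm]

theorem trace_mul_sum_conj {K : Type} [Fintype K] (Z Y : Matrix N N ℂ) (L : K → Matrix N N ℂ) :
    (Z * ∑ k, L k * Y * (L k)ᴴ).trace = ((∑ k, (L k)ᴴ * Z * L k) * Y).trace := by
  rw [Matrix.mul_sum, Matrix.sum_mul, Matrix.trace_sum, Matrix.trace_sum]
  refine Finset.sum_congr rfl fun k _ => ?_
  rw [← Matrix.mul_assoc, Matrix.trace_mul_comm]
  simp only [Matrix.mul_assoc]

end Record

/-! ### Channels with a record for each round -/

namespace Channel

variable {N : Type} [Fintype N] [DecidableEq N]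

/-- The channel with the given family of Kraus operators. -/
noncomputable def ofFamily {J : Type} [Fintype J] (κ : J → Matrix N N ℂ)
    (h : ∑ j, (κ j)ᴴ * κ j = 1) : Channel N where
  rank := Fintype.card J
  kraus i := κ ((Fintype.equivFin J).symm i)
  complete := by
    rw [← h]
    exact (Fintype.equivFin J).symm.sum_comp fun j => (κ j)ᴴ * κ j

theorem sum_ofFamily {J : Type} [Fintype J] (κ : J → Matrix N N ℂ)
    (h : ∑ j, (κ j)ᴴ * κ j = 1) {V : Type*} [AddCommMonoid V] (f : Matrix N N ℂ → V) :
    ∑ i, f ((ofFamily κ h).kraus i) = ∑ j, f (κ j) :=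
  (Fintype.equivFin J).symm.sum_comp fun j => f (κ j)

variable (Φ : ℕ → Channel N) (k : ℕ)

/-- What can be recorded about the channels `Φ 0, …, Φ (k - 1)`: nothing, or that some Kraus
operator of one of them was applied. -/
abbrev Note : Type := Option (Σ t : Fin k, Fin (Φ t).rank)

/-- The Kraus operators of `Φ t`, indexed by notes. -/
def noteKraus (t : Fin k) : Note Φ k → Matrix N N ℂ
  | none => 0
  | some x => if x.1 = t then (Φ x.1).kraus x.2 else 0

/-- One note type serves all rounds although their ranks differ; the blank note and those of other
rounds carry the operator `0`. -/
theorem sum_noteKraus (t : Fin k) {V : Type*} [AddCommMonoid V] (f : Matrix N N ℂ → V)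
    (hf : f 0 = 0) : ∑ j, f (noteKraus Φ k t j) = ∑ i, f ((Φ t).kraus i) := by
  rw [Fintype.sum_option, Fintype.sum_sigma]
  simp only [noteKraus, hf, zero_add]
  rw [Finset.sum_eq_single t]
  · simp
  · intro s _ hs; simp [hs, hf]
  · simp

/-- An array of `k` notes, next to a further register. -/
abbrev Record (E₀ : Type) : Type := E₀ × (Fin k → Note Φ k)

/-- Kraus operators that perform `Φ t` and make a note of it. -/
def recorded (E₀ : Type) [DecidableEq E₀] (t : ℕ) (v : Note Φ k) :
    Matrix (N × Record Φ k E₀) (N × Record Φ k E₀) ℂ :=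
  -- From round `k` on there is no cell left; a trivial channel serves as default.
  if h : t < k then recordKraus (noteKraus Φ k ⟨t, h⟩) ⟨t, h⟩ v else if v = none then 1 else 0

theorem recorded_complete (E₀ : Type) [Fintype E₀] [DecidableEq E₀] (t : ℕ) :
    ∑ v, (recorded Φ k E₀ t v)ᴴ * recorded Φ k E₀ t v = 1 := by
  by_cases h : t < k
  · simp only [recorded, dif_pos h]
    have h1 := sum_recordKraus_conj (E₀ := E₀) (noteKraus Φ k ⟨t, h⟩)
      (⟨t, h⟩ : Fin k) 1
    rw [Matrix.one_kronecker_one] at h1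
    simp only [Matrix.mul_one] at h1
    rw [h1, sum_noteKraus Φ k ⟨t, h⟩ (fun K => Kᴴ * K) (by simp), (Φ t).complete,
      Matrix.one_kronecker_one]
  · simp only [recorded, dif_neg h]
    rw [Finset.sum_eq_single none]
    · simp
    · intro v _ hv; simp [hv]
    · simp

end Channel

/-! ### Local operations next to the other party's environment -/

section Local

variable {A M B E : Type} [Fintype A] [DecidableEq A] [Fintype M] [DecidableEq M] [Fintype B]
  [DecidableEq B] [Fintype E] [DecidableEq E]

/-- Moving Alice's environment to the end, without Bob. -/
def aliceEnv (A M E : Type) : (A × E) × M ≃ (A × M) × E where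
  toFun p := ((p.1.1, p.2), p.1.2)
  invFun p := ((p.1.1, p.2), p.1.2)
  left_inv _ := rfl
  right_inv _ := rfl

/-- Moving Bob's environment to the end, without Alice. -/
def bobEnv (M B E : Type) : M × B × E ≃ (M × B) × E := (Equiv.prodAssoc M B E).symm

/-- Moving Alice's environment to the end. -/
def aliceEnv₃ (A M B E : Type) : (A × E) × M × B ≃ (A × M × B) × E where
  toFun p := ((p.1.1, p.2), p.1.2)
  invFun p := ((p.1.1, p.2), p.1.2)
  left_inv _ := rfl
  right_inv _ := rfl

/-- Moving Bob's environment to the end. -/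
def bobEnv₃ (A M B E : Type) : A × M × B × E ≃ (A × M × B) × E where
  toFun p := ((p.1, p.2.1, p.2.2.1), p.2.2.2)
  invFun p := (p.1.1, p.1.2.1, p.1.2.2, p.2)
  left_inv _ := rfl
  right_inv _ := rfl

theorem onAlice_apply (K : Matrix (A × M) (A × M) ℂ) (p q : A × M × B) :
    onAlice (B := B) K p q =
      K (p.1, p.2.1) (q.1, q.2.1) * (1 : Matrix B B ℂ) p.2.2 q.2.2 := rfl

theorem onBob_apply (K : Matrix (M × B) (M × B) ℂ) (p q : A × M × B) :
    onBob (A := A) K p q = (1 : Matrix A A ℂ) p.1 q.1 * K p.2 q.2 := rfl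

theorem one_prod_apply (a a' : A) (e e' : E) :
    (1 : Matrix (A × E) (A × E) ℂ) (a, e) (a', e') =
      (1 : Matrix A A ℂ) a a' * (1 : Matrix E E ℂ) e e' := by
  rw [← Matrix.one_kronecker_one]; rfl

theorem onBob_aliceEnv (K : Matrix (M × B) (M × B) ℂ) :
    onBob (A := A × E) K = ((onBob (A := A) K) ⊗ₖ (1 : Matrix E E ℂ)).submatrix
      (aliceEnv₃ A M B E) (aliceEnv₃ A M B E) := by
  ext ⟨⟨a, e⟩, m, b⟩ ⟨⟨a', e'⟩, m', b'⟩
  change (1 : Matrix (A × E) (A × E) ℂ) (a, e) (a', e') * K (m, b) (m', b') =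
    (1 : Matrix A A ℂ) a a' * K (m, b) (m', b') * (1 : Matrix E E ℂ) e e'
  rw [one_prod_apply]
  ring

theorem onAlice_bobEnv (K : Matrix (A × M) (A × M) ℂ) :
    onAlice (B := B × E) K = ((onAlice (B := B) K) ⊗ₖ (1 : Matrix E E ℂ)).submatrix
      (bobEnv₃ A M B E) (bobEnv₃ A M B E) := by
  ext ⟨a, m, b, e⟩ ⟨a', m', b', e'⟩
  change K (a, m) (a', m') * (1 : Matrix (B × E) (B × E) ℂ) (b, e) (b', e') =
    K (a, m) (a', m') * (1 : Matrix B B ℂ) b b' * (1 : Matrix E E ℂ) e e'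
  rw [one_prod_apply]
  ring

theorem onAlice_zero : onAlice (B := B) (0 : Matrix (A × M) (A × M) ℂ) = 0 := by
  simp [onAlice]

theorem onBob_zero : onBob (A := A) (0 : Matrix (M × B) (M × B) ℂ) = 0 := by
  simp [onBob]

variable {J : Type} [Fintype J] [DecidableEq J] {k : ℕ} {E₀ : Type} [Fintype E₀] [DecidableEq E₀]

theorem onAlice_recordKraus (κ : J → Matrix (A × M) (A × M) ℂ) (c : Fin k) (v : J) :
    onAlice (B := B) ((recordKraus (E₀ := E₀) κ c v).submatrix (aliceEnv A M _) (aliceEnv A M _)) =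
      (recordKraus (E₀ := E₀) (fun j => onAlice (B := B) (κ j)) c v).submatrix
        (aliceEnv₃ A M B _) (aliceEnv₃ A M B _) := by
  ext ⟨⟨a, e⟩, m, b⟩ ⟨⟨a', e'⟩, m', b'⟩
  simp only [onAlice_apply, Matrix.submatrix_apply, recordKraus, Matrix.sum_apply,
    Matrix.kroneckerMap_apply, aliceEnv₃, aliceEnv, Equiv.coe_fn_mk, Finset.sum_mul]
  refine Finset.sum_congr rfl fun j _ => ?_
  ring

theorem onBob_recordKraus (κ : J → Matrix (M × B) (M × B) ℂ) (c : Fin k) (v : J) :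
    onBob (A := A) ((recordKraus (E₀ := E₀) κ c v).submatrix (bobEnv M B _) (bobEnv M B _)) =
      (recordKraus (E₀ := E₀) (fun j => onBob (A := A) (κ j)) c v).submatrix
        (bobEnv₃ A M B _) (bobEnv₃ A M B _) := by
  ext ⟨a, m, b, e⟩ ⟨a', m', b', e'⟩
  simp only [onBob_apply, Matrix.submatrix_apply, recordKraus, Matrix.sum_apply,
    Matrix.kroneckerMap_apply, bobEnv₃, bobEnv, Equiv.prodAssoc_symm_apply, Equiv.coe_fn_mk,
    Finset.mul_sum]
  refine Finset.sum_congr rfl fun j _ => ?_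
  ring

theorem sum_conj_submatrix {P Q K : Type} [Fintype P] [Fintype Q] [Fintype K] (σ : P ≃ Q)
    (L : K → Matrix Q Q ℂ) (Z : Matrix Q Q ℂ) :
    ∑ j, ((L j).submatrix σ σ)ᴴ * Z.submatrix σ σ * (L j).submatrix σ σ =
      (∑ j, (L j)ᴴ * Z * L j).submatrix σ σ := by
  ext p q
  simp only [Matrix.conjTranspose_submatrix, Matrix.submatrix_mul_equiv, Matrix.sum_apply,
    Matrix.submatrix_apply]

/-- What Bob does, in the Heisenberg picture, next to Alice's environment. -/
theorem sum_onBob_conj_aliceEnv {K : Type} [Fintype K] (L : K → Matrix (M × B) (M × B) ℂ)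
    (Z : Matrix (A × M × B) (A × M × B) ℂ) :
    ∑ j, (onBob (A := A × E) (L j))ᴴ * (Z ⊗ₖ (1 : Matrix E E ℂ)).submatrix
        (aliceEnv₃ A M B E) (aliceEnv₃ A M B E) * onBob (A := A × E) (L j) =
      ((∑ j, (onBob (A := A) (L j))ᴴ * Z * onBob (A := A) (L j)) ⊗ₖ
        (1 : Matrix E E ℂ)).submatrix (aliceEnv₃ A M B E) (aliceEnv₃ A M B E) := by
  simp only [onBob_aliceEnv, sum_conj_submatrix, Matrix.conjTranspose_kronecker,
    Matrix.conjTranspose_one, ← Matrix.mul_kronecker_mul, Matrix.mul_one, Matrix.sum_kronecker]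

/-- What Alice does, in the Heisenberg picture, next to Bob's environment. -/
theorem sum_onAlice_conj_bobEnv {K : Type} [Fintype K] (L : K → Matrix (A × M) (A × M) ℂ)
    (Z : Matrix (A × M × B) (A × M × B) ℂ) :
    ∑ j, (onAlice (B := B × E) (L j))ᴴ * (Z ⊗ₖ (1 : Matrix E E ℂ)).submatrix
        (bobEnv₃ A M B E) (bobEnv₃ A M B E) * onAlice (B := B × E) (L j) =
      ((∑ j, (onAlice (B := B) (L j))ᴴ * Z * onAlice (B := B) (L j)) ⊗ₖ
        (1 : Matrix E E ℂ)).submatrix (bobEnv₃ A M B E) (bobEnv₃ A M B E) := by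
  simp only [onAlice_bobEnv, sum_conj_submatrix, Matrix.conjTranspose_kronecker,
    Matrix.conjTranspose_one, ← Matrix.mul_kronecker_mul, Matrix.mul_one, Matrix.sum_kronecker]

theorem onAlice_recorded (Φ : ℕ → Channel (A × M)) {t : ℕ} (ht : t < k)
    (v : Channel.Note Φ k) :
    onAlice (B := B) ((Channel.recorded Φ k E₀ t v).submatrix (aliceEnv A M _) (aliceEnv A M _)) =
      (recordKraus (fun j => onAlice (B := B) (Channel.noteKraus Φ k ⟨t, ht⟩ j))
        ⟨t, ht⟩ v).submatrix (aliceEnv₃ A M B (Channel.Record Φ k E₀))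
          (aliceEnv₃ A M B (Channel.Record Φ k E₀)) := by
  rw [Channel.recorded, dif_pos ht]
  exact onAlice_recordKraus _ _ _

theorem onBob_recorded (Φ : ℕ → Channel (M × B)) {t : ℕ} (ht : t < k)
    (v : Channel.Note Φ k) :
    onBob (A := A) ((Channel.recorded Φ k E₀ t v).submatrix (bobEnv M B _) (bobEnv M B _)) =
      (recordKraus (fun j => onBob (A := A) (Channel.noteKraus Φ k ⟨t, ht⟩ j))
        ⟨t, ht⟩ v).submatrix (bobEnv₃ A M B (Channel.Record Φ k E₀))
          (bobEnv₃ A M B (Channel.Record Φ k E₀)) := by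
  rw [Channel.recorded, dif_pos ht]
  exact onBob_recordKraus _ _ _

theorem sum_onAlice_conj_recorded (Φ : ℕ → Channel (A × M)) {t : ℕ} (ht : t < k)
    (Z : Matrix (A × M × B) (A × M × B) ℂ) :
    ∑ v, (onAlice (B := B) ((Channel.recorded Φ k E₀ t v).submatrix (aliceEnv A M _)
          (aliceEnv A M _)))ᴴ *
        (Z ⊗ₖ (1 : Matrix (Channel.Record Φ k E₀) (Channel.Record Φ k E₀) ℂ)).submatrix
          (aliceEnv₃ A M B _) (aliceEnv₃ A M B _) *
        onAlice (B := B) ((Channel.recorded Φ k E₀ t v).submatrix (aliceEnv A M _)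
          (aliceEnv A M _)) =
      ((∑ i, (onAlice (B := B) ((Φ t).kraus i))ᴴ * Z * onAlice (B := B) ((Φ t).kraus i)) ⊗ₖ
        (1 : Matrix (Channel.Record Φ k E₀) (Channel.Record Φ k E₀) ℂ)).submatrix
          (aliceEnv₃ A M B _) (aliceEnv₃ A M B _) := by
  simp only [onAlice_recorded Φ ht]
  rw [sum_conj_submatrix, sum_recordKraus_conj,
    Channel.sum_noteKraus Φ k ⟨t, ht⟩ (fun K => (onAlice (B := B) K)ᴴ * Z * onAlice (B := B) K)
      (by rw [onAlice_zero]; simp)]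

theorem sum_onBob_conj_recorded (Φ : ℕ → Channel (M × B)) {t : ℕ} (ht : t < k)
    (Z : Matrix (A × M × B) (A × M × B) ℂ) :
    ∑ v, (onBob (A := A) ((Channel.recorded Φ k E₀ t v).submatrix (bobEnv M B _)
          (bobEnv M B _)))ᴴ *
        (Z ⊗ₖ (1 : Matrix (Channel.Record Φ k E₀) (Channel.Record Φ k E₀) ℂ)).submatrix
          (bobEnv₃ A M B _) (bobEnv₃ A M B _) *
        onBob (A := A) ((Channel.recorded Φ k E₀ t v).submatrix (bobEnv M B _)
          (bobEnv M B _)) =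
      ((∑ i, (onBob (A := A) ((Φ t).kraus i))ᴴ * Z * onBob (A := A) ((Φ t).kraus i)) ⊗ₖ
        (1 : Matrix (Channel.Record Φ k E₀) (Channel.Record Φ k E₀) ℂ)).submatrix
          (bobEnv₃ A M B _) (bobEnv₃ A M B _) := by
  simp only [onBob_recorded Φ ht]
  rw [sum_conj_submatrix, sum_recordKraus_conj,
    Channel.sum_noteKraus Φ k ⟨t, ht⟩ (fun K => (onBob (A := A) K)ᴴ * Z * onBob (A := A) K)
      (by rw [onBob_zero]; simp)]

end Local

/-! ### Purified strategies and their indistinguishability -/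

section Purification

variable {M : Type} [Fintype M] [DecidableEq M]

/-- The coefficients of a purification of Alice's initial state. -/
noncomputable def AliceStrategy.startRoot (S : AliceStrategy M) :
    Matrix (S.A × M) (S.A × M) ℂ :=
  S.isDensity.posSemidef.exists_eq_mul_conjTranspose.choose

theorem AliceStrategy.start_eq (S : AliceStrategy M) :
    S.start = S.startRoot * S.startRootᴴ :=
  S.isDensity.posSemidef.exists_eq_mul_conjTranspose.choose_spec

/-- The coefficients of a purification of Bob's initial state. -/
noncomputable def BobStrategy.startRoot (T : BobStrategy M) : Matrix T.B T.B ℂ :=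
  T.isDensity.posSemidef.exists_eq_mul_conjTranspose.choose

theorem BobStrategy.start_eq (T : BobStrategy M) :
    T.start = T.startRoot * T.startRootᴴ :=
  T.isDensity.posSemidef.exists_eq_mul_conjTranspose.choose_spec

/-- The purification with coefficients `C`, together with an array of blank cells. -/
def blankVec {P E₀ ι J : Type} [DecidableEq J] [Fintype ι] (v₀ : J) (C : Matrix P E₀ ℂ) :
    P × E₀ × (ι → J) → ℂ :=
  fun p => if p.2.2 = fun _ => v₀ then C p.1 p.2.1 else 0

theorem sum_blankVec {P E₀ ι J : Type} [DecidableEq J] [Fintype J] [Fintype ι] [DecidableEq ι]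
    [Fintype E₀] (v₀ : J) (C : Matrix P E₀ ℂ) (p q : P) :
    ∑ e : E₀ × (ι → J), blankVec v₀ C (p, e) * star (blankVec v₀ C (q, e)) = (C * Cᴴ) p q := by
  rw [Fintype.sum_prod_type, Matrix.mul_apply]
  refine Finset.sum_congr rfl fun e _ => ?_
  rw [Finset.sum_eq_single fun _ => v₀]
  · simp [blankVec]
  · intro c _ hc; simp [blankVec, hc]
  · simp

theorem trace_blankVec {P E₀ ι J : Type} [Fintype P] [DecidableEq J] [Fintype J] [Fintype ι]
    [DecidableEq ι] [Fintype E₀] (v₀ : J) (C : Matrix P E₀ ℂ) :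
    (Matrix.vecMulVec (blankVec (ι := ι) v₀ C) (star (blankVec v₀ C))).trace =
      (C * Cᴴ).trace := by
  simp only [Matrix.trace, Matrix.diag, Matrix.vecMulVec_apply, Pi.star_apply,
    ← sum_blankVec (ι := ι) v₀ C]
  rw [Fintype.sum_prod_type]

/-- Alice purifies her initial state and records, in each of the first `k` rounds, which Kraus
operator was applied. -/
noncomputable def AliceStrategy.dilate (S : AliceStrategy M) (k : ℕ) : AliceStrategy M where
  A := S.A × Channel.Record S.op k (S.A × M)
  start := (Matrix.vecMulVec (blankVec none S.startRoot)
    (star (blankVec none S.startRoot))).submatrix (aliceEnv S.A M _) (aliceEnv S.A M _)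
  isDensity := ⟨(Matrix.posSemidef_vecMulVec_self_star _).submatrix _, by
    rw [← S.isDensity.trace_eq_one, S.start_eq,
      ← trace_blankVec (ι := Fin k) (none : Channel.Note S.op k)]
    exact (aliceEnv S.A M _).sum_comp fun p => Matrix.vecMulVec (blankVec none S.startRoot)
      (star (blankVec none S.startRoot)) p p⟩
  op t := Channel.ofFamily
    (fun v => (Channel.recorded S.op k (S.A × M) t v).submatrix (aliceEnv S.A M _)
      (aliceEnv S.A M _)) (by
      simp only [Matrix.conjTranspose_submatrix, Matrix.submatrix_mul_equiv]
      ext p q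
      rw [Matrix.sum_apply]
      simp only [Matrix.submatrix_apply]
      rw [← Matrix.sum_apply, Channel.recorded_complete, Matrix.one_apply, Matrix.one_apply]
      simp)

/-- Bob purifies his initial state and records, in each of the first `k` rounds, which Kraus
operator was applied. -/
noncomputable def BobStrategy.dilate (T : BobStrategy M) (k : ℕ) : BobStrategy M where
  B := T.B × Channel.Record T.op k T.B
  start := Matrix.vecMulVec (blankVec none T.startRoot) (star (blankVec none T.startRoot))
  isDensity := ⟨Matrix.posSemidef_vecMulVec_self_star _, by
    rw [← T.isDensity.trace_eq_one, T.start_eq,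
      ← trace_blankVec (ι := Fin k) (none : Channel.Note T.op k)]⟩
  op t := Channel.ofFamily
    (fun v => (Channel.recorded T.op k T.B t v).submatrix (bobEnv M T.B _) (bobEnv M T.B _)) (by
      simp only [Matrix.conjTranspose_submatrix, Matrix.submatrix_mul_equiv]
      ext p q
      rw [Matrix.sum_apply]
      simp only [Matrix.submatrix_apply]
      rw [← Matrix.sum_apply, Channel.recorded_complete, Matrix.one_apply, Matrix.one_apply]
      simp)

variable (S : AliceStrategy M) (T : BobStrategy M)

/-- One move of Alice and one of Bob. -/
theorem jointState_succ (t : ℕ) :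
    jointState S T (t + 1) = ∑ j, onBob ((T.op t).kraus j) *
      (∑ i, onAlice ((S.op t).kraus i) * jointState S T t * (onAlice ((S.op t).kraus i))ᴴ) *
      (onBob ((T.op t).kraus j))ᴴ := rfl

theorem Matrix.trace_mul_congr {P : Type} [Fintype P] {X X' : Matrix P P ℂ} (h : X = X')
    (Y : Matrix P P ℂ) : (X * Y).trace = (X' * Y).trace := by
  rw [h]

theorem AliceStrategy.sum_op_dilate (k t : ℕ) {V : Type*} [AddCommMonoid V]
    (f : Matrix ((S.A × Channel.Record S.op k (S.A × M)) × M)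
      ((S.A × Channel.Record S.op k (S.A × M)) × M) ℂ → V) :
    ∑ i, f (((S.dilate k).op t).kraus i) =
      ∑ v, f ((Channel.recorded S.op k (S.A × M) t v).submatrix (aliceEnv S.A M _)
        (aliceEnv S.A M _)) :=
  Channel.sum_ofFamily _ _ f

theorem BobStrategy.sum_op_dilate (k t : ℕ) {V : Type*} [AddCommMonoid V]
    (f : Matrix (M × T.B × Channel.Record T.op k T.B)
      (M × T.B × Channel.Record T.op k T.B) ℂ → V) :
    ∑ i, f (((T.dilate k).op t).kraus i) =
      ∑ v, f ((Channel.recorded T.op k T.B t v).submatrix (bobEnv M T.B _) (bobEnv M T.B _)) :=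
  Channel.sum_ofFamily _ _ f

/-- Alice's environment, traced out in the Heisenberg picture. -/
theorem trace_jointState_dilate_alice (k t : ℕ) (ht : t ≤ k)
    (Z : Matrix (S.A × M × T.B) (S.A × M × T.B) ℂ) :
    (((Z ⊗ₖ (1 : Matrix (Channel.Record S.op k (S.A × M)) _ ℂ)).submatrix
      (aliceEnv₃ S.A M T.B _) (aliceEnv₃ S.A M T.B _) :
        Matrix ((S.dilate k).A × M × T.B) ((S.dilate k).A × M × T.B) ℂ) *
      jointState (S.dilate k) T t).trace = (Z * jointState S T t).trace := by
  -- The adjoint of each move sends `Z ⊗ₖ 1` to some `Z' ⊗ₖ 1`, so the induction has to cover all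
  -- `Z`.
  induction t generalizing Z with
  | zero =>
    refine (trace_submatrix_kronecker_one_mul (aliceEnv₃ S.A M T.B _) Z _).trans ?_
    congr 2
    ext ⟨a, m, b⟩ ⟨a', m', b'⟩
    change ∑ e, (blankVec none S.startRoot ((a, m), e) *
      star (blankVec none S.startRoot ((a', m'), e))) * T.start b b' =
      S.start (a, m) (a', m') * T.start b b'
    rw [← Finset.sum_mul, sum_blankVec, ← S.start_eq]
  | succ t ih =>
    have ht' : t < k := ht
    rw [jointState_succ, jointState_succ]
    refine (trace_mul_sum_conj _ _ _).trans (Eq.trans ?_ (trace_mul_sum_conj _ _ _).symm)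
    refine (Matrix.trace_mul_congr (sum_onBob_conj_aliceEnv
      (E := Channel.Record S.op k (S.A × M)) (T.op t).kraus Z) _).trans ?_
    refine (trace_mul_sum_conj _ _ _).trans (Eq.trans ?_ (trace_mul_sum_conj _ _ _).symm)
    refine Eq.trans ?_ (ih ht'.le _)
    refine Matrix.trace_mul_congr ?_ _
    exact (S.sum_op_dilate k t fun K =>
      (onAlice (B := T.B) K)ᴴ * ((∑ j, (onBob (A := S.A) ((T.op t).kraus j))ᴴ * Z *
        onBob (A := S.A) ((T.op t).kraus j)) ⊗ₖ
        (1 : Matrix (Channel.Record S.op k (S.A × M)) _ ℂ)).submatrix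
        (aliceEnv₃ S.A M T.B _) (aliceEnv₃ S.A M T.B _) * onAlice (B := T.B) K).trans
      (sum_onAlice_conj_recorded S.op ht' _)

/-- Bob's environment, traced out in the Heisenberg picture. -/
theorem trace_jointState_dilate_bob (k t : ℕ) (ht : t ≤ k)
    (Z : Matrix (S.A × M × T.B) (S.A × M × T.B) ℂ) :
    (((Z ⊗ₖ (1 : Matrix (Channel.Record T.op k T.B) _ ℂ)).submatrix
      (bobEnv₃ S.A M T.B _) (bobEnv₃ S.A M T.B _) :
        Matrix (S.A × M × (T.dilate k).B) (S.A × M × (T.dilate k).B) ℂ) *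
      jointState S (T.dilate k) t).trace = (Z * jointState S T t).trace := by
  induction t generalizing Z with
  | zero =>
    refine (trace_submatrix_kronecker_one_mul (bobEnv₃ S.A M T.B _) Z _).trans ?_
    congr 2
    ext ⟨a, m, b⟩ ⟨a', m', b'⟩
    change ∑ e, S.start (a, m) (a', m') * (blankVec none T.startRoot (b, e) *
      star (blankVec none T.startRoot (b', e))) =
      S.start (a, m) (a', m') * T.start b b'
    rw [← Finset.mul_sum, sum_blankVec, ← T.start_eq]
  | succ t ih =>
    have ht' : t < k := ht
    rw [jointState_succ, jointState_succ]
    refine (trace_mul_sum_conj _ _ _).trans (Eq.trans ?_ (trace_mul_sum_conj _ _ _).symm)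
    have h1 := (T.sum_op_dilate k t fun K =>
      (onBob (A := S.A) K)ᴴ * (Z ⊗ₖ (1 : Matrix (Channel.Record T.op k T.B) _ ℂ)).submatrix
        (bobEnv₃ S.A M T.B _) (bobEnv₃ S.A M T.B _) * onBob (A := S.A) K).trans
      (sum_onBob_conj_recorded T.op ht' Z)
    refine (Matrix.trace_mul_congr h1 _).trans ?_
    refine (trace_mul_sum_conj _ _ _).trans (Eq.trans ?_ (trace_mul_sum_conj _ _ _).symm)
    refine Eq.trans ?_ (ih ht'.le _)
    exact Matrix.trace_mul_congr
      (sum_onAlice_conj_bobEnv (E := Channel.Record T.op k T.B) (S.op t).kraus _) _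

end Purification

/-! ### Purity of the joint state -/

section LocalVec

variable {A M B E : Type} [Fintype A] [DecidableEq A] [Fintype M] [DecidableEq M] [Fintype B]
  [DecidableEq B] [Fintype E] [DecidableEq E] {k : ℕ} {E₀ : Type} [Fintype E₀] [DecidableEq E₀]

theorem onAlice_mulVec_eq_zero (K : Matrix (A × M) (A × M) ℂ) {x : A × M × B × E → ℂ} {e : E}
    (hx : ∀ n, x ((bobEnv₃ A M B E).symm (n, e)) = 0) (n : A × M × B) :
    (onAlice (B := B × E) K *ᵥ x) ((bobEnv₃ A M B E).symm (n, e)) = 0 := by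
  rw [onAlice_bobEnv, Matrix.submatrix_mulVec_equiv, Function.comp_apply, Equiv.apply_symm_apply]
  exact kronecker_one_mulVec_eq_zero _ hx n

theorem onBob_mulVec_eq_zero (K : Matrix (M × B) (M × B) ℂ) {x : (A × E) × M × B → ℂ} {e : E}
    (hx : ∀ n, x ((aliceEnv₃ A M B E).symm (n, e)) = 0) (n : A × M × B) :
    (onBob (A := A × E) K *ᵥ x) ((aliceEnv₃ A M B E).symm (n, e)) = 0 := by
  rw [onBob_aliceEnv, Matrix.submatrix_mulVec_equiv, Function.comp_apply, Equiv.apply_symm_apply]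
  exact kronecker_one_mulVec_eq_zero _ hx n

theorem recordKraus_submatrix_mulVec_eq_zero {N P ι J : Type} [Fintype N] [DecidableEq N]
    [Fintype P] [Fintype ι] [DecidableEq ι] [Fintype J] [DecidableEq J]
    (σ : P ≃ N × E₀ × (ι → J)) (κ : J → Matrix N N ℂ) {c : ι} {v₀ v : J} (hv : v ≠ v₀)
    {x : P → ℂ} (hx : ∀ n e, e.2 c ≠ v₀ → x (σ.symm (n, e)) = 0) :
    (recordKraus κ c v).submatrix σ σ *ᵥ x = 0 := by
  rw [Matrix.submatrix_mulVec_equiv, recordKraus_mulVec_eq_zero κ hv hx]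
  rfl

theorem recordKraus_submatrix_mulVec_blank {N P ι J : Type} [Fintype N] [DecidableEq N]
    [Fintype P] [Fintype ι] [DecidableEq ι] [Fintype J] [DecidableEq J]
    (σ : P ≃ N × E₀ × (ι → J)) (κ : J → Matrix N N ℂ) {c s : ι} (hs : s ≠ c) (v₀ v : J)
    {x : P → ℂ} (hx : ∀ n e, e.2 s ≠ v₀ → x (σ.symm (n, e)) = 0) (n : N) (e : E₀ × (ι → J))
    (he : e.2 s ≠ v₀) : ((recordKraus κ c v).submatrix σ σ *ᵥ x) (σ.symm (n, e)) = 0 := by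
  rw [Matrix.submatrix_mulVec_equiv, Function.comp_apply, Equiv.apply_symm_apply]
  exact recordKraus_mulVec_blank κ hs v₀ v hx n e he

/-- If the record cell is blank, then Alice's recorded channel maps pure states to pure states. -/
theorem sum_onAlice_recorded_pure (Φ : ℕ → Channel (A × M)) {t : ℕ} (ht : t < k)
    {x : (A × Channel.Record Φ k E₀) × M × B → ℂ}
    (hx : ∀ s : Fin k, t ≤ s → ∀ n e, e.2 s ≠ none → x ((aliceEnv₃ A M B _).symm (n, e)) = 0) :
    ∃ K : Matrix ((A × Channel.Record Φ k E₀) × M) ((A × Channel.Record Φ k E₀) × M) ℂ,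
      ∑ v, onAlice (B := B) ((Channel.recorded Φ k E₀ t v).submatrix (aliceEnv A M _)
          (aliceEnv A M _)) * Matrix.vecMulVec x (star x) *
        (onAlice (B := B) ((Channel.recorded Φ k E₀ t v).submatrix (aliceEnv A M _)
          (aliceEnv A M _)))ᴴ =
        Matrix.vecMulVec (onAlice (B := B) K *ᵥ x) (star (onAlice (B := B) K *ᵥ x)) ∧
      ∀ s : Fin k, t + 1 ≤ s → ∀ n e, e.2 s ≠ none →
        (onAlice (B := B) K *ᵥ x) ((aliceEnv₃ A M B _).symm (n, e)) = 0 := by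
  -- Cell `t` is blank, so only the operator for the discarded content `none` survives. It writes to
  -- cell `t` alone and leaves the later ones blank.
  refine ⟨(Channel.recorded Φ k E₀ t none).submatrix (aliceEnv A M _) (aliceEnv A M _), ?_, ?_⟩
  · refine Matrix.sum_mul_vecMulVec_mul_conjTranspose fun v hv => ?_
    rw [onAlice_recorded Φ ht]
    exact recordKraus_submatrix_mulVec_eq_zero _ _ hv (hx ⟨t, ht⟩ le_rfl)
  · intro s hs n e he
    rw [onAlice_recorded Φ ht]
    refine recordKraus_submatrix_mulVec_blank _ _ ?_ none none
      (hx s (Nat.le_of_succ_le hs)) n e he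
    rintro rfl
    exact Nat.not_succ_le_self _ hs

/-- If the record cell is blank, then Bob's recorded channel maps pure states to pure states. -/
theorem sum_onBob_recorded_pure (Φ : ℕ → Channel (M × B)) {t : ℕ} (ht : t < k)
    {x : A × M × B × Channel.Record Φ k E₀ → ℂ}
    (hx : ∀ s : Fin k, t ≤ s → ∀ n e, e.2 s ≠ none → x ((bobEnv₃ A M B _).symm (n, e)) = 0) :
    ∃ K : Matrix (M × B × Channel.Record Φ k E₀) (M × B × Channel.Record Φ k E₀) ℂ,
      ∑ v, onBob (A := A) ((Channel.recorded Φ k E₀ t v).submatrix (bobEnv M B _)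
          (bobEnv M B _)) * Matrix.vecMulVec x (star x) *
        (onBob (A := A) ((Channel.recorded Φ k E₀ t v).submatrix (bobEnv M B _)
          (bobEnv M B _)))ᴴ =
        Matrix.vecMulVec (onBob (A := A) K *ᵥ x) (star (onBob (A := A) K *ᵥ x)) ∧
      ∀ s : Fin k, t + 1 ≤ s → ∀ n e, e.2 s ≠ none →
        (onBob (A := A) K *ᵥ x) ((bobEnv₃ A M B _).symm (n, e)) = 0 := by
  refine ⟨(Channel.recorded Φ k E₀ t none).submatrix (bobEnv M B _) (bobEnv M B _), ?_, ?_⟩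
  · refine Matrix.sum_mul_vecMulVec_mul_conjTranspose fun v hv => ?_
    rw [onBob_recorded Φ ht]
    exact recordKraus_submatrix_mulVec_eq_zero _ _ hv (hx ⟨t, ht⟩ le_rfl)
  · intro s hs n e he
    rw [onBob_recorded Φ ht]
    refine recordKraus_submatrix_mulVec_blank _ _ ?_ none none
      (hx s (Nat.le_of_succ_le hs)) n e he
    rintro rfl
    exact Nat.not_succ_le_self _ hs

end LocalVec

section Purification

variable {M : Type} [Fintype M] [DecidableEq M] (S : AliceStrategy M) (T : BobStrategy M)

/-- If both parties purify what they do, then the joint state is pure, and the cells that are not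
yet in use are blank. -/
theorem exists_jointState_dilate_eq (k t : ℕ) (ht : t ≤ k) :
    ∃ x : (S.A × Channel.Record S.op k (S.A × M)) × M × T.B × Channel.Record T.op k T.B → ℂ,
      jointState (S.dilate k) (T.dilate k) t = Matrix.vecMulVec x (star x) ∧
      (∀ s : Fin k, t ≤ s → ∀ n e, e.2 s ≠ none →
        x ((aliceEnv₃ S.A M (T.B × Channel.Record T.op k T.B) _).symm (n, e)) = 0) ∧
      (∀ s : Fin k, t ≤ s → ∀ n e, e.2 s ≠ none →
        x ((bobEnv₃ (S.A × Channel.Record S.op k (S.A × M)) M T.B _).symm (n, e)) = 0) := by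
  induction t with
  | zero =>
    refine ⟨fun p => blankVec none S.startRoot ((p.1.1, p.2.1), p.1.2) *
      blankVec none T.startRoot p.2.2, ?_, ?_, ?_⟩
    · ext ⟨⟨a, e⟩, m, b, f⟩ ⟨⟨a', e'⟩, m', b', f'⟩
      change (blankVec none S.startRoot ((a, m), e) *
          star (blankVec none S.startRoot ((a', m'), e'))) *
        (blankVec none T.startRoot (b, f) * star (blankVec none T.startRoot (b', f'))) =
        (blankVec none S.startRoot ((a, m), e) * blankVec none T.startRoot (b, f)) *
        star (blankVec none S.startRoot ((a', m'), e') * blankVec none T.startRoot (b', f'))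
      rw [star_mul']
      ring
    · rintro s - ⟨a, m, b⟩ e he
      have : e.2 ≠ fun _ => none := fun h => he (by rw [h])
      simp [blankVec, aliceEnv₃, this]
    · rintro s - ⟨a, m, b⟩ e he
      have : e.2 ≠ fun _ => none := fun h => he (by rw [h])
      simp [blankVec, bobEnv₃, this]
  | succ t ih =>
    have ht' : t < k := ht
    obtain ⟨x, hx, hxA, hxB⟩ := ih ht'.le
    obtain ⟨K, hK, hKA⟩ := sum_onAlice_recorded_pure S.op ht' hxA
    -- Alice's move cannot disturb Bob's blank cells; the last goal is the mirror image.
    have hKB : ∀ s : Fin k, t ≤ s → ∀ n e, e.2 s ≠ none → (onAlice K *ᵥ x)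
        ((bobEnv₃ (S.A × Channel.Record S.op k (S.A × M)) M T.B _).symm (n, e)) = 0 :=
      fun s hs n e he => onAlice_mulVec_eq_zero K (fun n => hxB s hs n e he) n
    obtain ⟨L, hL, hLB⟩ := sum_onBob_recorded_pure T.op ht' hKB
    refine ⟨onBob L *ᵥ (onAlice K *ᵥ x), ?_, ?_, hLB⟩
    · have h1 := (S.sum_op_dilate k t fun K =>
        onAlice (B := T.B × Channel.Record T.op k T.B) K * Matrix.vecMulVec x (star x) *
          (onAlice K)ᴴ).trans hK
      have h2 := (T.sum_op_dilate k t fun L =>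
        onBob (A := S.A × Channel.Record S.op k (S.A × M)) L *
          Matrix.vecMulVec (onAlice K *ᵥ x) (star (onAlice K *ᵥ x)) * (onBob L)ᴴ).trans hL
      rw [jointState_succ, hx]
      refine Eq.trans ?_ h2
      exact Finset.sum_congr rfl fun j _ => congrArg
        (fun Y : Matrix ((S.dilate k).A × M × (T.dilate k).B) _ ℂ =>
          onBob (A := (S.dilate k).A) (((T.dilate k).op t).kraus j) * Y *
            (onBob (A := (S.dilate k).A) (((T.dilate k).op t).kraus j))ᴴ) h1
    · exact fun s hs n e he => onBob_mulVec_eq_zero L (fun n => hKA s hs n e he) n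

theorem IsPOVM.kronecker_one {K H E : Type} [Fintype K] [Fintype H] [DecidableEq H] [Fintype E]
    [DecidableEq E] {F : K → Matrix H H ℂ} (hF : IsPOVM F) :
    IsPOVM fun i => F i ⊗ₖ (1 : Matrix E E ℂ) :=
  ⟨fun i => (hF.posSemidef i).kronecker Matrix.PosSemidef.one, by
    rw [← Matrix.sum_kronecker, hF.sum_eq_one, Matrix.one_kronecker_one]⟩

theorem IsPOVM.submatrix {K P Q : Type} [Fintype K] [Fintype P] [DecidableEq P] [Fintype Q]
    [DecidableEq Q] {F : K → Matrix Q Q ℂ} (hF : IsPOVM F) (σ : P ≃ Q) :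
    IsPOVM fun i => (F i).submatrix σ σ :=
  ⟨fun i => (hF.posSemidef i).submatrix σ, by
    ext p q
    rw [Matrix.sum_apply]
    simp only [Matrix.submatrix_apply]
    rw [← Matrix.sum_apply, hF.sum_eq_one, Matrix.one_apply, Matrix.one_apply]
    simp⟩


/-- Both parties can purify what they do in the first `k` rounds: nobody who has access to the
registers of the original strategies only will notice it, and the final state is pure. -/
theorem exists_purification (k : ℕ) :
    ∃ (S' : AliceStrategy M) (T' : BobStrategy M) (lA : Matrix S.A S.A ℂ → Matrix S'.A S'.A ℂ)
      (lB : Matrix (M × T.B) (M × T.B) ℂ → Matrix (M × T'.B) (M × T'.B) ℂ)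
      (C : Matrix S'.A (M × T'.B) ℂ),
      (∀ (K : Type) [Fintype K] (E : K → Matrix S.A S.A ℂ), IsPOVM E →
        IsPOVM fun i => lA (E i)) ∧
      (∀ (K : Type) [Fintype K] (F : K → Matrix (M × T.B) (M × T.B) ℂ), IsPOVM F →
        IsPOVM fun i => lB (F i)) ∧
      (∀ T₀ E F, outcomeProb k S' T₀ (lA E) F = outcomeProb k S T₀ E F) ∧
      (∀ S₀ E F, outcomeProb k S₀ T' E (lB F) = outcomeProb k S₀ T E F) ∧
      ∀ E F, outcomeProb k S' T' E F = ((E * C * Fᵀ * Cᴴ).trace).re := by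
  obtain ⟨x, hx⟩ : ∃ x : (S.dilate k).A × M × (T.dilate k).B → ℂ,
      jointState (S.dilate k) (T.dilate k) k = Matrix.vecMulVec x (star x) :=
    let ⟨x, hx, _⟩ := exists_jointState_dilate_eq S T k k le_rfl
    ⟨x, hx⟩
  refine ⟨S.dilate k, T.dilate k,
    fun E => E ⊗ₖ (1 : Matrix (Channel.Record S.op k (S.A × M)) _ ℂ),
    fun F => (F ⊗ₖ (1 : Matrix (Channel.Record T.op k T.B) _ ℂ)).submatrix
      (bobEnv M T.B _) (bobEnv M T.B _), fun a q => x (a, q),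
    fun K _ E hE => hE.kronecker_one, fun K _ F hF => hF.kronecker_one.submatrix _, ?_, ?_, ?_⟩
  · intro T₀ E F
    refine Eq.trans ?_ (congrArg Complex.re
      (trace_jointState_dilate_alice S T₀ k k le_rfl (E ⊗ₖ F)))
    refine congrArg Complex.re (Matrix.trace_mul_congr ?_ _)
    ext ⟨⟨a, e⟩, q⟩ ⟨⟨a', e'⟩, q'⟩
    exact mul_right_comm (E a a') ((1 : Matrix (Channel.Record S.op k (S.A × M)) _ ℂ) e e') (F q q')
  · intro S₀ E F
    refine Eq.trans ?_ (congrArg Complex.re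
      (trace_jointState_dilate_bob S₀ T k k le_rfl (E ⊗ₖ F)))
    refine congrArg Complex.re (Matrix.trace_mul_congr ?_ _)
    ext ⟨a, m, b, f⟩ ⟨a', m', b', f'⟩
    exact (mul_assoc (E a a') (F (m, b) (m', b'))
      ((1 : Matrix (Channel.Record T.op k T.B) _ ℂ) f f')).symm
  · intro E F
    rw [outcomeProb, hx]
    exact congrArg Complex.re (trace_kronecker_mul_vecMulVec (fun a q => x (a, q)) E F)

end Purification

/-! ### From secure protocols to encodings -/

namespace Protocol

variable {n : ℕ} {P : Protocol n} {p : ℝ}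

/-- A secure protocol yields an encoding: the final state of a purifying Bob, given the strings of
a purifying Alice. -/
theorem IsOT.exists_encoding (hP : P.IsOT p) (hA : P.SecureAgainstAlice)
    (hB : P.SecureAgainstBob) :
    ∃ e : Encoding n, e.HidesXor ∧
      ∃ D : Bits n → Bits n → Matrix e.H e.H ℂ, (∀ c, IsPOVM (D c)) ∧
        1 / 2 ^ n * ∑ c : Bits n, e.decodeProb (mix c) (D c) = p := by
  obtain ⟨S, T, lA, lB, C, hlA, hlB, hS, hT, hC⟩ := exists_purification P.alice P.bob P.rounds
  have h2n : (2 : ℝ) ^ n ≠ 0 := by positivity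
  have h2n0 : (0 : ℂ) ≤ ((2 ^ n : ℝ) : ℂ) := Complex.zero_le_real.2 (by positivity)
  set E := fun u => lA (P.aliceOut u) with hE
  set F := fun v => lB (P.bobOut v) with hF
  have hEP : IsPOVM E := hlA _ _ P.aliceOut_isPOVM
  have hFP : IsPOVM F := hlB _ _ P.bobOut_isPOVM
  have honest : ∀ u v, outcomeProb P.rounds S T (E u) (F v) = P.honestProb u v := fun u v => by
    rw [hE, hF, hS, hT, honestProb]
  have psd : ∀ v, (C * (F v)ᵀ * Cᴴ).PosSemidef := fun v =>
    (hFP.posSemidef v).transpose.mul_mul_conjTranspose_same C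
  -- the states of Alice, given Bob's index string
  set α : Bits n → Matrix S.A S.A ℂ := fun b => ∑ w, C * (F (some (b, w)))ᵀ * Cᴴ with hα
  have hαpsd : ∀ b, (α b).PosSemidef := fun b => Matrix.posSemidef_sum _ fun w _ => psd _
  -- The purifying Alice `S` is a cheater against the honest Bob. Her success in guessing `b` does
  -- not depend on her measurement, so her conditional states agree.
  have hαeq : ∀ b b', α b = α b' := by
    refine eq_of_trace_povm_const (fun b => (hαpsd b).isHermitian)
      (c := 1 / 2 ^ n * ∑ b, ∑ w, outcomeProb P.rounds S P.bob 1 (P.bobOut (some (b, w))))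
      fun G hG => ?_
    rw [← hA S G hG]
    refine Finset.sum_congr rfl fun b _ => ?_
    simp only [hα, Matrix.mul_sum, Matrix.trace_sum, Complex.re_sum]
    refine Finset.sum_congr rfl fun w _ => ?_
    rw [← hT, hC]
    simp only [hF, Matrix.mul_assoc]
  -- Purification preserves the honest statistics, in which Bob never aborts. Thus the states `α b`
  -- add up to Alice's whole reduced state.
  have hnone : C * (F none)ᵀ * Cᴴ = 0 := by
    rw [← (psd none).trace_eq_zero_iff, ← (psd none).ofReal_re_trace, Complex.ofReal_eq_zero]
    have h1 := hC 1 (F none)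
    rw [Matrix.one_mul] at h1
    rw [← h1, ← hEP.sum_eq_one, outcomeProb_sum_left]
    simp only [honest]
    exact hP.bob_no_abort
  have hαsum : ∀ b, ((2 ^ n : ℝ) : ℂ) • α b = C * Cᴴ := by
    intro b
    have h1 : C * (∑ v, F v)ᵀ * Cᴴ = ∑ b, α b := by
      rw [Matrix.transpose_sum, Matrix.mul_sum, Matrix.sum_mul, Fintype.sum_option, hnone,
        zero_add, Fintype.sum_prod_type]
    rw [hFP.sum_eq_one, Matrix.transpose_one, Matrix.mul_one,
      Finset.sum_congr rfl fun b' _ => hαeq b' b, Finset.sum_const, Finset.card_univ,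
      Bits.card] at h1
    rw [h1, ← Nat.cast_smul_eq_nsmul ℂ]
    push_cast
    rfl
  -- For every `b`, the rescaled branches `(b, w)` decompose the same reduced state of Alice. So Bob
  -- can realize them by a measurement in which `b` is his choice instead of an outcome.
  have hsteer : ∀ b : Bits n, ∃ G : Bits n → Matrix (P.M × T.B) (P.M × T.B) ℂ, IsPOVM G ∧
      ∀ w, C * G w * Cᴴ = ((2 ^ n : ℝ) : ℂ) • (C * (F (some (b, w)))ᵀ * Cᴴ) := fun b =>
    exists_isPOVM_steering C _ (fun w => (psd _).smul h2n0) (by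
      rw [← Finset.smul_sum, ← hαsum b])
  choose G hG hGC using hsteer
  have psd' : ∀ u, ((Cᴴ * E u * C)ᵀ).PosSemidef := fun u =>
    ((hEP.posSemidef u).conjTranspose_mul_mul_same C).transpose
  have hdec : ∀ u (G : Matrix (P.M × T.B) (P.M × T.B) ℂ),
      ((G * (Cᴴ * E u * C)ᵀ).trace).re = outcomeProb P.rounds S T (E u) G := fun u G => by
    rw [hC, trace_mul_steered]
  have huniform : ∀ z₀ z₁, outcomeProb P.rounds S T (E (some (z₀, z₁))) 1 =
      1 / 2 ^ n * (1 / 2 ^ n) := fun z₀ z₁ => by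
    rw [← hFP.sum_eq_one, outcomeProb_sum_right]
    simp only [honest]
    exact hP.alice_uniform z₀ z₁
  let e : Encoding n :=
    { H := P.M × T.B
      prior := fun _ _ => 1 / 2 ^ n * (1 / 2 ^ n)
      prior_nonneg := fun _ _ => by positivity
      prior_sum := by
        simp only [Bits.sum_const]
        field_simp
      state := fun z₀ z₁ => ((2 ^ n * 2 ^ n : ℝ) : ℂ) • (Cᴴ * E (some (z₀, z₁)) * C)ᵀ
      isDensity := fun z₀ z₁ => by
        refine ⟨(psd' _).smul (Complex.zero_le_real.2 (by positivity)), ?_⟩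
        have h1 := hdec (some (z₀, z₁)) 1
        rw [Matrix.one_mul, huniform] at h1
        rw [Matrix.trace_smul, ← (psd' _).ofReal_re_trace, h1, smul_eq_mul, ← Complex.ofReal_mul,
          Complex.ofReal_eq_one]
        field_simp }
  have hedec : ∀ f (K : Bits n → Matrix (P.M × T.B) (P.M × T.B) ℂ), e.decodeProb f K =
      ∑ z₀, ∑ z₁, outcomeProb P.rounds S T (E (some (z₀, z₁))) (K (f z₀ z₁)) := by
    intro f K
    refine Finset.sum_congr rfl fun z₀ _ => Finset.sum_congr rfl fun z₁ _ => ?_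
    rw [← hdec]
    change (1 / 2 ^ n * (1 / 2 ^ n)) * ((K (f z₀ z₁) * (((2 ^ n * 2 ^ n : ℝ) : ℂ) •
      (Cᴴ * E (some (z₀, z₁)) * C)ᵀ)).trace).re = _
    rw [Matrix.mul_smul, Matrix.trace_smul, smul_eq_mul, Complex.re_ofReal_mul]
    field_simp
  refine ⟨e, Encoding.hidesXor_of_forall
    fun (K : Bits n → Matrix (P.M × T.B) (P.M × T.B) ℂ) hK => ?_, fun c w => (G c w)ᵀ,
    fun c => ⟨fun w => ((hG c).posSemidef w).transpose, ?_⟩, ?_⟩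
  -- The purifying Bob `T` is a cheater against the honest Alice, so security against Bob applies to
  -- every measurement of his final system.
  · have h1 := hB T K hK
    simp only [← hS] at h1
    refine (hedec _ K).trans (h1.trans ?_)
    have h2 : ∀ z₀ z₁, outcomeProb P.rounds S T (lA (P.aliceOut (some (z₀, z₁)))) 1 =
      1 / 2 ^ n * (1 / 2 ^ n) := huniform
    simp only [h2, Bits.sum_const]
    field_simp
  · have h1 : ∑ w, (G c w)ᵀ = (1 : Matrix (P.M × T.B) (P.M × T.B) ℂ) := by
      rw [← Matrix.transpose_sum, (hG c).sum_eq_one, Matrix.transpose_one]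
    exact h1
  -- Imposing `c` multiplies the honest probabilities by `2 ^ n`, that is, conditions on an index of
  -- probability `1 / 2 ^ n`; averaging over `c` undoes this and gives `p`.
  · have h1 : ∀ c z₀ z₁, outcomeProb P.rounds S T (E (some (z₀, z₁))) (G c (mix c z₀ z₁))ᵀ =
        2 ^ n * P.honestProb (some (z₀, z₁)) (some (c, mix c z₀ z₁)) := by
      intro c z₀ z₁
      rw [← honest, hC, hC, Matrix.transpose_transpose, Matrix.mul_assoc, Matrix.mul_assoc,
        ← Matrix.mul_assoc C, hGC, Matrix.mul_smul, Matrix.trace_smul, smul_eq_mul,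
        Complex.re_ofReal_mul]
      simp only [Matrix.mul_assoc]
    have h2 : ∀ c, e.decodeProb (mix c) (fun w => (G c w)ᵀ) =
        ∑ z₀, ∑ z₁, 2 ^ n * P.honestProb (some (z₀, z₁)) (some (c, mix c z₀ z₁)) := by
      intro c
      refine (hedec (mix c) fun w => (G c w)ᵀ).trans ?_
      simp only [h1]
    rw [Finset.sum_congr rfl fun c _ => h2 c, ← hP.correct]
    simp only [← Finset.mul_sum]
    rw [← mul_assoc, one_div_mul_cancel h2n, one_mul, Finset.sum_comm]
    exact Finset.sum_congr rfl fun z₀ _ => Finset.sum_comm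

end Protocol

/-- In the first list, `Pr[learn x_c]` is the maximum over all measurements; it is never below
`1 / 2 ^ n` on average, which is why `1 / 2 ^ n ≤ p` is needed there. In the second list, where
`p` is arbitrary, `x_c` is decoded by some measurement `D c`. -/
theorem theorem4 (n : ℕ) (p : ℝ) :
    (1 / 2 ^ n ≤ p →
      List.TFAE [
        ∃ e : Encoding n, e.HidesXor ∧ 1 / 2 ^ n * ∑ c : Bits n, e.learnProb (mix c) = p,
        ∃ P : Protocol n, P.NonInteractive ∧ P.IsOT p ∧ P.Secure,
        ∃ P : Protocol n, P.IsOT p ∧ P.Secure,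
        ∃ S : CHSHStrategy n, S.winProb = p]) ∧
    List.TFAE [
      ∃ e : Encoding n, e.HidesXor ∧
        ∃ D : Bits n → Bits n → Matrix e.H e.H ℂ, (∀ c, IsPOVM (D c)) ∧
          1 / 2 ^ n * ∑ c : Bits n, e.decodeProb (mix c) (D c) = p,
      ∃ P : Protocol n, P.NonInteractive ∧ P.IsOT p ∧ P.Secure,
      ∃ P : Protocol n, P.IsOT p ∧ P.Secure,
      ∃ S : CHSHStrategy n, S.winProb = p] := by
  have hmain : List.TFAE [
      ∃ e : Encoding n, e.HidesXor ∧
        ∃ D : Bits n → Bits n → Matrix e.H e.H ℂ, (∀ c, IsPOVM (D c)) ∧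
          1 / 2 ^ n * ∑ c : Bits n, e.decodeProb (mix c) (D c) = p,
      ∃ P : Protocol n, P.NonInteractive ∧ P.IsOT p ∧ P.Secure,
      ∃ P : Protocol n, P.IsOT p ∧ P.Secure,
      ∃ S : CHSHStrategy n, S.winProb = p] := by
    tfae_have 1 → 2 := by
      rintro ⟨e, he, D, hD, rfl⟩
      exact ⟨Encoding.toProtocol he D hD, rfl, Encoding.toProtocol_isOT he D hD,
        Encoding.toProtocol_secureAgainstAlice he D hD,
        Encoding.toProtocol_secureAgainstBob he D hD⟩
    tfae_have 2 → 3 := fun ⟨P, _, hP⟩ => ⟨P, hP⟩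
    tfae_have 3 → 1 := fun ⟨_, hP, hA, hB⟩ => hP.exists_encoding hA hB
    tfae_have 1 → 4 := by
      rintro ⟨e, he, D, hD, rfl⟩
      exact he.exists_chshStrategy hD
    tfae_have 4 → 1 := by
      rintro ⟨S, rfl⟩
      exact ⟨S.toEncoding, S.toEncoding_hidesXor, S.bob, S.bob_isPOVM,
        S.sum_decodeProb_toEncoding⟩
    tfae_finish
  refine ⟨fun hp => ?_, hmain⟩
  tfae_have 1 → 4 := by
    rintro ⟨e, he, h⟩
    obtain ⟨D, hD, hDp⟩ := e.exists_isPOVM_of_learnProb h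
    have h14 := (hmain.out 0 3).1
    exact h14 ⟨e, he, D, hD, hDp⟩
  tfae_have 4 → 1 := by
    intro h
    obtain ⟨e, he, D, hD, hDp⟩ := (hmain.out 0 3).2 h
    exact e.exists_learnProb_of_isPOVM hp he hD hDp
  tfae_have 2 ↔ 4 := hmain.out 1 3
  tfae_have 3 ↔ 4 := hmain.out 2 3
  tfae_finish
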